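/- Let $N\ge 1$, let $P,Q$ be endomorphisms of $V=\mathbb{C}^N$, where $Q$ is a non-zero multiple of a rank one idempotent, and write $Q(x)=\phi(x)v$ with $v\in V$, $\phi\in V^*$. For an endomorphism $A$ of $V$ with eigenvalues $\alpha_1,\dots,\alpha_N$, consider the following conditions: the $\alpha_i$ are distinct and no two of them differ by a positive integer, and $A$ is in general position with respect to $Q$, i.e. if $x_1,\dots,x_N$ are corresponding eigenvectors of $A$, then $\phi(x_i)\neq 0$ for all $i$ and $v=\sum_i d_i x_i$ with $d_i\ne 0$ for all $i$; the eigenvectors are then normalised by $\phi(x_i)=1$. Assume that $P$ and $R=Q-P$ both satisfy these conditions, with eigenvalues $\lambda_i$ and normalised eigenvectors $\xi_i$ for $P$, and eigenvalues $-\mu_j$ and normalised eigenvectors $\zeta_j$ for $R$ (so that the $\mu_j$ are the eigenvalues of $P-Q$). Consider the differential equation $$\frac{df}{dz}=\frac{Pf}{z}+\frac{Qf}{1-z}\qquad (1)$$ on $\mathbb{C}\setminus[0,\infty)$, where powers are defined by $z^a=e^{a\log z}$ with $0<\operatorname{Im}\log z<2\pi$. Then there are holomorphic solutions $f_i$ and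 $h_j$ ($1\le i,j\le N$) of (1) on $\mathbb{C}\setminus[0,\infty)$ with convergent expansions $$f_i(z)=\sum_{n\ge0}\xi_{i,n}z^{\lambda_i+n}\quad(|z|<1),\qquad h_j(z)=\sum_{n\ge 0}\zeta_{j,n}z^{\mu_j-n}\quad(|z|>1),$$ where $\xi_{i,0}=\xi_i$ and $\zeta_{j,0}=\zeta_j$. For any such solutions there is exactly one matrix $(c_{ij})$ (the transport matrix) with $f_i(z)=\sum_j c_{ij}h_j(z)$ for all $i$ and all $z\in\mathbb{C}\setminus[0,\infty)$, and it is given by $$c_{ij}=e^{i\pi(\lambda_i-\mu_j)}\,\frac{\prod_{k\ne i}\Gamma(\lambda_i-\lambda_k+1)\,\prod_{\ell\neq j}\Gamma(\mu_j-\mu_\ell)}{\prod_{\ell\ne j}\Gamma(\lambda_i-\mu_\ell+1)\,\prod_{k\neq i}\Gamma(\mu_j-\lambda_k)},$$ where $1/\Gamma$ is taken to be $0$ at the poles of $\Gamma$, and the $i$ in $e^{i\pi(\lambda_i-\mu_j)}$ is the imaginary unit. -/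

import Mathlib

namespace BasicODE

noncomputable section

/-- The space `ℂ^N` in which the differential equation takes its values. -/
abbrev V (N : ℕ) : Type := Fin N → ℂ

/-- `Q` is a non-zero multiple of a rank one idempotent. -/
def IsMultipleOfRankOneIdempotent {N : ℕ} (Q : Module.End ℂ (V N)) : Prop :=
  ∃ (δ : ℂ) (E : Module.End ℂ (V N)),
    δ ≠ 0 ∧ IsIdempotentElem E ∧ Module.finrank ℂ (LinearMap.range E) = 1 ∧ Q = δ • E

/-- The conditions on an operator `A` relative to the rank one operator `x ↦ φ x • v`: the `N`
eigenvalues `α i` of `A` are distinct, no two of them differ by a positive integer, and `A` is in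
general position, that is `φ` is non-zero on the eigenvectors and all the coefficients of `v` in
terms of the eigenvectors are non-zero. The `x i` are the eigenvectors normalised by
`φ (x i) = 1`. -/
structure IsNormalizedEigensystem {N : ℕ} (φ : V N →ₗ[ℂ] ℂ) (v : V N)
    (A : Module.End ℂ (V N)) (α : Fin N → ℂ) (x : Fin N → V N) : Prop where
  apply_eq : ∀ i, A (x i) = α i • x i
  distinct : Function.Injective α
  nonresonant : ∀ i k, ∀ n : ℕ, 0 < n → α i - α k ≠ (n : ℂ)
  normalized : ∀ i, φ (x i) = 1
  generalPosition : ∃ d : Fin N → ℂ, (∀ i, d i ≠ 0) ∧ v = ∑ i, d i • x i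

/-- The cut plane `ℂ ∖ [0, ∞)`. -/
def cutPlane : Set ℂ := ((fun x : ℝ => (x : ℂ)) '' Set.Ici 0)ᶜ

/-- The power `z ^ a` on `ℂ ∖ [0, ∞)`, for the branch of the logarithm whose imaginary part lies
in `(0, 2π)`. -/
def cutPow (z a : ℂ) : ℂ := Complex.exp (a * (Complex.log (-z) + Real.pi * Complex.I))

/-- `f` solves `df/dz = P f / z + Q f / (1 - z)` on `ℂ ∖ [0, ∞)`. -/
def IsSolution {N : ℕ} (P Q : Module.End ℂ (V N)) (f : ℂ → V N) : Prop :=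
  ∀ z ∈ cutPlane, HasDerivAt f (z⁻¹ • P (f z) + (1 - z)⁻¹ • Q (f z)) z

/-- `f` is the solution on `ℂ ∖ [0, ∞)` that is given for `|z| < 1` by a convergent expansion
`∑ ξₙ z ^ (lam + n)` with `ξ₀ = ξ`. -/
def IsSolutionAtZero {N : ℕ} (P Q : Module.End ℂ (V N)) (lam : ℂ) (ξ : V N)
    (f : ℂ → V N) : Prop :=
  IsSolution P Q f ∧
    ∃ a : ℕ → V N, a 0 = ξ ∧
      ∀ z ∈ cutPlane, ‖z‖ < 1 → HasSum (fun n : ℕ => cutPow z (lam + n) • a n) (f z)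

/-- `h` is the solution on `ℂ ∖ [0, ∞)` that is given for `|z| > 1` by a convergent expansion
`∑ ζₙ z ^ (mu - n)` with `ζ₀ = ζ`. -/
def IsSolutionAtInfty {N : ℕ} (P Q : Module.End ℂ (V N)) (mu : ℂ) (ζ : V N)
    (h : ℂ → V N) : Prop :=
  IsSolution P Q h ∧
    ∃ b : ℕ → V N, b 0 = ζ ∧
      ∀ z ∈ cutPlane, 1 < ‖z‖ → HasSum (fun n : ℕ => cutPow z (mu - n) • b n) (h z)

/-- `c` is a transport matrix from the `f i` to the `h j`. -/
def IsTransportMatrix {N : ℕ} (f h : Fin N → ℂ → V N) (c : Fin N → Fin N → ℂ) : Prop :=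
  ∀ i, ∀ z ∈ cutPlane, f i z = ∑ j, c i j • h j z

end

end BasicODE

/-!
Write `f` for a solution with exponent `λᵢ` at `0`. Since `Q` has rank one, the Taylor coefficients
of `z ^ (-λᵢ) * φ (f z) / (1 - z)` satisfy a two-term recursion: if `(s - P) y = κ v`, then
`κ det (s - P + Q) = (κ + φ y) det (s - P)`, so consecutive coefficients have the ratio
`∏ⱼ (λᵢ + n + 1 - μⱼ) / ∏ₖ (λᵢ + n + 1 - λₖ)`. They belong to a generalised hypergeometric series,
whose analytic continuation is an iterated Euler beta integral. Comparing its behaviour along the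
negative real axis with `f = ∑ⱼ cᵢⱼ hⱼ` yields `cᵢⱼ` when the exponent of `hⱼ` dominates the others;
in general the others are first lowered by operators `z d/dz + β`. Applied to `f = 0`, the same
computation shows that the `hⱼ` are linearly independent, hence span the space of solutions.

The solutions themselves come from the Koebe substitution `z = 4 t / (1 + t) ^ 2`, which maps the
unit disc onto `ℂ ∖ [1, ∞)`: it turns the Frobenius recursion at `0` into a three-term recursion
whose series converges on the whole disc. Replacing `z` by `1 / z` exchanges `P` with `Q - P` and
gives the solutions at infinity.
-/

namespace BasicODE

open Filter Topology Set Complex MeasureTheory Polynomial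

/-! ### Power series on the unit disc -/

section PowerSeries

theorem summable_norm_mul_pow_of_le {E : Type*} [NormedAddCommGroup E] {c : ℕ → E} {r ρ B : ℝ}
    (hr : 0 ≤ r) (hrρ : r < ρ) (hB : ∀ n, ‖c n‖ * ρ ^ n ≤ B) : Summable fun n => ‖c n‖ * r ^ n := by
  have hρ : 0 < ρ := hr.trans_lt hrρ
  have geometric : Summable fun n : ℕ => B * (r / ρ) ^ n :=
    (summable_geometric_of_lt_one (by positivity) ((div_lt_one hρ).2 hrρ)).mul_left B
  refine geometric.of_nonneg_of_le (fun n => by positivity) fun n => ?_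
  calc ‖c n‖ * r ^ n = ‖c n‖ * ρ ^ n * (r / ρ) ^ n := by rw [div_pow]; field_simp
    _ ≤ B * (r / ρ) ^ n := by gcongr; exact hB n

variable {E : Type*} [NormedAddCommGroup E] [NormedSpace ℂ E] {b c : ℕ → E} {g h : ℂ → E}

/-- `g` is the sum of the power series `∑ cₙ xⁿ` on the open unit disc. -/
def HasDiscSum (c : ℕ → E) (g : ℂ → E) : Prop :=
  ∀ x : ℂ, ‖x‖ < 1 → HasSum (fun n => x ^ n • c n) (g x)

/-- The coefficients of the power series `x * ∑ cₙ xⁿ`. -/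
def shiftCoeff (c : ℕ → E) : ℕ → E
  | 0 => 0
  | n + 1 => c n

theorem exists_norm_mul_pow_le_of_summable {x : ℂ} (hx : Summable fun n => x ^ n • c n) :
    ∃ B, ∀ n, ‖c n‖ * ‖x‖ ^ n ≤ B := by
  obtain ⟨B, hB⟩ := hx.tendsto_atTop_zero.norm.bddAbove_range
  refine ⟨B, fun n => ?_⟩
  simpa [norm_smul, mul_comm] using hB ⟨n, rfl⟩

theorem exists_hasDiscSum_of_norm_mul_pow_le [CompleteSpace E]
    (hc : ∀ ρ : ℝ, 0 < ρ → ρ < 1 → ∃ B, ∀ n, ‖c n‖ * ρ ^ n ≤ B) : ∃ g, HasDiscSum c g := by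
  refine ⟨fun x => ∑' n, x ^ n • c n, fun x hx => (Summable.of_norm ?_).hasSum⟩
  obtain ⟨ρ, hxρ, hρ⟩ := exists_between hx
  obtain ⟨B, hB⟩ := hc ρ ((norm_nonneg x).trans_lt hxρ) hρ
  simpa [norm_smul, mul_comm] using summable_norm_mul_pow_of_le (norm_nonneg x) hxρ hB

theorem exists_hasDiscSum_of_differentiableOn [CompleteSpace E]
    (hg : DifferentiableOn ℂ g (Metric.ball 0 1)) : ∃ c, HasDiscSum c g := by
  refine ⟨fun n => (n.factorial : ℂ)⁻¹ • iteratedDeriv n g 0, fun x hx => ?_⟩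
  refine (hasSum_taylorSeries_on_ball hg (mem_ball_zero_iff.2 hx)).congr_fun fun n => ?_
  simp only [sub_zero, smul_smul, mul_comm]

namespace HasDiscSum

theorem apply_zero (hg : HasDiscSum c g) : g 0 = c 0 := by
  refine (hg 0 (by simp)).unique ?_
  simpa using hasSum_single (f := fun n : ℕ => (0 : ℂ) ^ n • c n) 0 fun n hn => by simp [hn]

theorem summable_norm_mul_pow (hg : HasDiscSum c g) {r : ℝ} (hr0 : 0 ≤ r) (hr1 : r < 1) :
    Summable fun n => ‖c n‖ * r ^ n := by
  obtain ⟨ρ, hrρ, hρ⟩ := exists_between hr1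
  have norm_ρ : ‖(ρ : ℂ)‖ = ρ := by rw [norm_real, Real.norm_of_nonneg (hr0.trans hrρ.le)]
  obtain ⟨B, hB⟩ := exists_norm_mul_pow_le_of_summable (hg ρ (by rwa [norm_ρ])).summable
  exact summable_norm_mul_pow_of_le hr0 hrρ (by simpa only [norm_ρ] using hB)

theorem congr (hg : HasDiscSum c g) (hgh : ∀ x, ‖x‖ < 1 → g x = h x) : HasDiscSum c h :=
  fun x hx => hgh x hx ▸ hg x hx

theorem add (hg : HasDiscSum b g) (hh : HasDiscSum c h) :
    HasDiscSum (fun n => b n + c n) fun x => g x + h x :=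
  fun x hx => by simpa only [smul_add] using (hg x hx).add (hh x hx)

theorem sub (hg : HasDiscSum b g) (hh : HasDiscSum c h) :
    HasDiscSum (fun n => b n - c n) fun x => g x - h x :=
  fun x hx => by simpa only [smul_sub] using (hg x hx).sub (hh x hx)

theorem map {F : Type*} [NormedAddCommGroup F] [NormedSpace ℂ F] (hg : HasDiscSum c g)
    (T : E →L[ℂ] F) : HasDiscSum (fun n => T (c n)) fun x => T (g x) :=
  fun x hx => by simpa only [map_smul] using T.hasSum (hg x hx)

theorem smul_shift (hg : HasDiscSum c g) : HasDiscSum (shiftCoeff c) fun x => x • g x := by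
  intro x hx
  rw [← hasSum_nat_add_iff' 1]
  simpa [shiftCoeff, pow_succ', mul_smul] using (hg x hx).const_smul x

theorem unique (hg : HasDiscSum b g) (hh : HasDiscSum c g) : b = c := by
  have hasFPowerSeriesAt : ∀ {a : ℕ → E}, HasDiscSum a g → HasFPowerSeriesAt g
      (fun n => .mkPiRing ℂ (Fin n) (a n) : FormalMultilinearSeries ℂ ℂ E) 0 := fun {a} ha => by
    refine hasFPowerSeriesAt_iff.2 ?_
    filter_upwards [Metric.ball_mem_nhds 0 one_pos] with x hx
    simpa [FormalMultilinearSeries.coeff] using ha x (by simpa using hx)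
  funext n
  have := congrFun ((hasFPowerSeriesAt hg).eq_formalMultilinearSeries (hasFPowerSeriesAt hh)) n
  exact ContinuousMultilinearMap.mkPiRing_eq_iff.1 this

variable [CompleteSpace E]

theorem differentiableOn_and_smul_deriv (hg : HasDiscSum c g) :
    DifferentiableOn ℂ g (Metric.ball 0 1) ∧
      HasDiscSum (fun n => (n : ℂ) • c n) fun x => x • deriv g x := by
  have key : ∀ x : ℂ, ‖x‖ < 1 → DifferentiableAt ℂ g x ∧
      HasSum (fun n : ℕ => x ^ n • (n : ℂ) • c n) (x • deriv g x) := by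
    intro x hx
    obtain ⟨ρ, hxρ, hρ⟩ := exists_between hx
    have summable := hg.summable_norm_mul_pow ((norm_nonneg x).trans hxρ.le) hρ
    have term_diff (n : ℕ) : DifferentiableOn ℂ (fun w : ℂ => w ^ n • c n) (Metric.ball 0 ρ) := by
      fun_prop
    have term_le (n : ℕ) (w : ℂ) (hw : w ∈ Metric.ball 0 ρ) : ‖w ^ n • c n‖ ≤ ‖c n‖ * ρ ^ n := by
      rw [norm_smul, norm_pow, mul_comm]
      gcongr
      exact (mem_ball_zero_iff.1 hw).le
    have mem : x ∈ Metric.ball 0 ρ := mem_ball_zero_iff.2 hxρ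
    have eq_tsum : g =ᶠ[𝓝 x] fun w => ∑' n, w ^ n • c n := by
      filter_upwards [Metric.isOpen_ball.mem_nhds mem] with w hw
      exact (hg w ((mem_ball_zero_iff.1 hw).trans hρ)).tsum_eq.symm
    have tsum_diff := differentiableOn_tsum_of_summable_norm summable term_diff
      Metric.isOpen_ball term_le
    refine ⟨(tsum_diff.differentiableAt
      (Metric.isOpen_ball.mem_nhds mem)).congr_of_eventuallyEq eq_tsum, ?_⟩
    rw [eq_tsum.deriv_eq]
    refine ((hasSum_deriv_of_summable_norm summable term_diff Metric.isOpen_ball term_le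
      mem).const_smul x).congr_fun fun n => ?_
    rw [((hasDerivAt_pow n x).smul_const (c n)).deriv, smul_smul, smul_smul]
    cases n with
    | zero => simp
    | succ n => congr 1; simp only [pow_succ, Nat.add_sub_cancel]; ring
  exact ⟨fun x hx => (key x (mem_ball_zero_iff.1 hx)).1.differentiableWithinAt,
    fun x hx => (key x hx).2⟩

theorem differentiableOn (hg : HasDiscSum c g) : DifferentiableOn ℂ g (Metric.ball 0 1) :=
  hg.differentiableOn_and_smul_deriv.1

theorem smul_deriv (hg : HasDiscSum c g) :
    HasDiscSum (fun n => (n : ℂ) • c n) fun x => x • deriv g x :=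
  hg.differentiableOn_and_smul_deriv.2

end HasDiscSum

end PowerSeries

/-! ### Beta integrals and asymptotics at infinity -/

theorem differentiableOn_integral_mul_comp_mul {w : ℝ → ℂ}
    (hw : IntervalIntegrable w volume 0 1) {U : Set ℂ} (hU : IsOpen U)
    (hU0 : StarConvex ℝ 0 U) {H : ℂ → ℂ} (hH : DifferentiableOn ℂ H U) :
    DifferentiableOn ℂ (fun z => ∫ t in (0 : ℝ)..1, w t * H (t * z)) U := by
  intro z hz
  obtain ⟨r, hr, hrU⟩ := Metric.nhds_basis_closedBall.mem_iff.1 (hU.mem_nhds hz)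
  have maps : ∀ t ∈ uIcc (0 : ℝ) 1, ∀ y ∈ U, (t : ℂ) * y ∈ U := fun t ht y hy => by
    rw [uIcc_of_le zero_le_one] at ht
    simpa using hU0.smul_mem hy ht.1 ht.2
  have integrable : ∀ {f : ℂ → ℂ}, ContinuousOn f U → ∀ y ∈ U,
      IntervalIntegrable (fun t : ℝ => w t * f (t * y)) volume 0 1 := fun hf y hy =>
    hw.mul_continuousOn (hf.comp (by fun_prop) fun t ht => maps t ht y hy)
  have deriv_cont : ContinuousOn (fun q : ℝ × ℂ => deriv H (q.1 * q.2) * q.1)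
      (uIcc 0 1 ×ˢ Metric.closedBall z r) :=
    ((hH.deriv hU).continuousOn.comp (by fun_prop)
      fun q hq => maps q.1 hq.1 q.2 (hrU hq.2)).mul (by fun_prop)
  obtain ⟨K, hK⟩ := (isCompact_uIcc.prod (isCompact_closedBall z r)).exists_bound_of_continuousOn
    deriv_cont
  refine (intervalIntegral.hasDerivAt_integral_of_dominated_loc_of_deriv_le
    (F' := fun y t => w t * (deriv H (t * y) * t)) (bound := fun t => ‖w t‖ * K)
    (Metric.closedBall_mem_nhds z hr) ?_ (integrable hH.continuousOn z hz) ?_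
    (ae_of_all _ fun t ht y hy => ?_) (hw.norm.mul_const K)
    (ae_of_all _ fun t ht y hy => ?_)).2.differentiableAt.differentiableWithinAt
  · filter_upwards [hU.mem_nhds hz] with y hy
    exact (integrable hH.continuousOn y hy).def'.aestronglyMeasurable
  · simpa only [mul_assoc] using
      ((integrable (hH.deriv hU).continuousOn z hz).mul_continuousOn
        (g := fun t : ℝ => (t : ℂ)) (by fun_prop)).def'.aestronglyMeasurable
  · rw [norm_mul]
    gcongr
    exact hK (t, y) ⟨uIoc_subset_uIcc ht, hy⟩
  · have inner : HasDerivAt (fun y : ℂ => (t : ℂ) * y) t y := by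
      simpa using (hasDerivAt_id y).const_mul (t : ℂ)
    have outer := (hH.differentiableAt
      (hU.mem_nhds (maps t (uIoc_subset_uIcc ht) y (hrU hy)))).hasDerivAt
    exact (outer.comp y inner).const_mul (w t)

theorem hasDiscSum_integral_mul_comp_mul {w : ℝ → ℂ} (hw : IntervalIntegrable w volume 0 1)
    {H : ℂ → ℂ} {a : ℕ → ℂ} (hH : HasDiscSum a H) :
    HasDiscSum (fun n => a n * ∫ t in (0 : ℝ)..1, w t * t ^ n)
      fun z => ∫ t in (0 : ℝ)..1, w t * H (t * z) := by
  intro z hz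
  have norm_le_one : ∀ t ∈ uIoc (0 : ℝ) 1, ‖(t : ℂ)‖ ≤ 1 := fun t ht => by
    rw [uIoc_of_le zero_le_one] at ht
    rw [norm_real, Real.norm_of_nonneg ht.1.le]
    exact ht.2
  have summable : Summable fun n => ‖z ^ n * a n‖ := (hH z hz).summable.norm
  have := intervalIntegral.hasSum_integral_of_dominated_convergence
    (F := fun n t => w t * ((t * z) ^ n * a n)) (f := fun t : ℝ => w t * H (t * z))
    (μ := volume) (a := 0) (b := 1) (fun n t => ‖w t‖ * ‖z ^ n * a n‖)
    (fun n => (hw.mul_continuousOn (by fun_prop)).def'.aestronglyMeasurable)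
    (fun n => ae_of_all _ fun t ht => ?_) (ae_of_all _ fun t _ => summable.mul_left _) ?_
    (ae_of_all _ fun t ht => (hH _ ?_).mul_left (w t))
  · refine this.congr_fun fun n => ?_
    simp only [smul_eq_mul, ← intervalIntegral.integral_const_mul]
    refine intervalIntegral.integral_congr fun t _ => ?_
    ring
  · rw [norm_mul, mul_pow, mul_assoc, norm_mul (_ ^ n), norm_pow]
    gcongr
    exact mul_le_of_le_one_left (norm_nonneg _) (pow_le_one₀ (norm_nonneg _) (norm_le_one t ht))
  · simp only [tsum_mul_left]
    exact hw.norm.mul_const _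
  · rw [norm_mul]
    exact mul_lt_one_of_nonneg_of_lt_one_right (norm_le_one t ht) (norm_nonneg z) hz

/-- The complex plane cut along `[1, ∞)`. -/
def unitCutPlane : Set ℂ := {z | 1 - z ∈ slitPlane}

theorem isOpen_unitCutPlane : IsOpen unitCutPlane :=
  isOpen_slitPlane.preimage (by fun_prop)

theorem starConvex_unitCutPlane : StarConvex ℝ 0 unitCutPlane := by
  rw [starConvex_zero_iff]
  intro z hz t ht0 ht1
  have := StarConvex.add_smul_mem starConvex_one_slitPlane (y := -z)
    (by simpa [unitCutPlane, sub_eq_add_neg] using hz) ht0 ht1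
  simpa [unitCutPlane, sub_eq_add_neg] using this

theorem ball_subset_unitCutPlane : Metric.ball (0 : ℂ) 1 ⊆ unitCutPlane := fun z hz => by
  simpa [unitCutPlane, sub_eq_add_neg] using
    mem_slitPlane_of_norm_lt_one (z := -z) (by simpa using hz)

theorem neg_ofReal_mem_unitCutPlane {x : ℝ} (hx : 0 ≤ x) : -(x : ℂ) ∈ unitCutPlane := by
  refine Or.inl ?_
  simp only [sub_neg_eq_add, add_re, one_re, ofReal_re]
  positivity

theorem norm_one_add_div_cpow_le (α : ℂ) {t x : ℝ} (ht0 : 0 < t) (ht1 : t ≤ 1) (hx : 0 ≤ x) :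
    ‖(((1 + x) / (1 + t * x) : ℝ) : ℂ) ^ α‖ ≤ 1 + ‖(t : ℂ) ^ (-α)‖ := by
  have one_le : 1 ≤ (1 + x) / (1 + t * x) := by
    rw [one_le_div (by positivity)]
    nlinarith
  have le_inv : (1 + x) / (1 + t * x) ≤ t⁻¹ := by
    rw [div_le_iff₀ (by positivity), inv_mul_eq_div, le_div_iff₀ ht0]
    nlinarith
  rw [norm_cpow_eq_rpow_re_of_pos (by positivity), norm_cpow_eq_rpow_re_of_pos ht0, neg_re,
    Real.rpow_neg ht0.le, ← Real.inv_rpow ht0.le]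
  rcases le_total 0 α.re with h | h
  · exact (Real.rpow_le_rpow (by positivity) le_inv h).trans (by simp)
  · exact (Real.rpow_le_one_of_one_le_of_nonpos one_le h).trans
      (le_add_of_nonneg_right (by positivity))

theorem tendsto_one_add_div_cpow (α : ℂ) {t : ℝ} (ht : 0 < t) :
    Tendsto (fun x : ℝ => (((1 + x) / (1 + t * x) : ℝ) : ℂ) ^ α) atTop (𝓝 ((t : ℂ) ^ (-α))) := by
  have base : Tendsto (fun x : ℝ => (1 + x) / (1 + t * x)) atTop (𝓝 t⁻¹) := by
    have h : Tendsto (fun x : ℝ => (x⁻¹ + 1) / (x⁻¹ + t)) atTop (𝓝 ((0 + 1) / (0 + t))) :=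
      (tendsto_inv_atTop_zero.add_const 1).div (tendsto_inv_atTop_zero.add_const t)
        (by simp [ht.ne'])
    rw [zero_add, zero_add, one_div] at h
    refine h.congr' ?_
    filter_upwards [eventually_gt_atTop 0] with x hx
    field_simp
  have : (t : ℂ) ^ (-α) = ((t⁻¹ : ℝ) : ℂ) ^ α := by
    have arg_ne : arg (t : ℂ) ≠ Real.pi := by
      simp [arg_ofReal_of_nonneg ht.le, Real.pi_ne_zero.symm]
    rw [ofReal_inv, inv_cpow _ _ arg_ne, cpow_neg]
  rw [this]
  exact ((continuousAt_cpow_const (ofReal_mem_slitPlane.2 (inv_pos.2 ht))).comp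
    continuous_ofReal.continuousAt).tendsto.comp base

theorem one_add_cpow_eq_mul (α : ℂ) {t x : ℝ} (ht : 0 ≤ t) (hx : 0 ≤ x) :
    ((1 + x : ℝ) : ℂ) ^ α
      = (((1 + x) / (1 + t * x) : ℝ) : ℂ) ^ α * ((1 + t * x : ℝ) : ℂ) ^ α := by
  rw [← mul_cpow_ofReal_nonneg (by positivity) (by positivity), ← ofReal_mul,
    div_mul_cancel₀ _ (by positivity)]

theorem exists_norm_le_of_tendsto_atTop {g : ℝ → ℂ} (hg : ContinuousOn g (Ici 0)) {L : ℂ}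
    (h : Tendsto g atTop (𝓝 L)) : ∃ K, ∀ x, 0 ≤ x → ‖g x‖ ≤ K := by
  obtain ⟨B, hB⟩ := eventually_atTop.1 (h.norm.eventually_le_const (lt_add_one ‖L‖))
  obtain ⟨C, hC⟩ := isCompact_Icc.exists_bound_of_continuousOn
    (hg.mono (Icc_subset_Ici_self : Icc 0 B ⊆ Ici 0))
  refine ⟨max C (‖L‖ + 1), fun x hx => ?_⟩
  rcases le_total x B with h | h
  · exact (hC x ⟨hx, h⟩).trans (le_max_left _ _)
  · exact (hB x h).trans (le_max_right _ _)

theorem tendsto_cpow_mul_integral_mul_comp_mul {w : ℝ → ℂ} {α L : ℂ} {H : ℂ → ℂ}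
    (hw : IntervalIntegrable w volume 0 1)
    (hwα : IntervalIntegrable (fun t => w t * (t : ℂ) ^ (-α)) volume 0 1)
    (hH : ContinuousOn H unitCutPlane)
    (hL : Tendsto (fun x : ℝ => ((1 + x : ℝ) : ℂ) ^ α * H (-x)) atTop (𝓝 L)) :
    Tendsto (fun x : ℝ => ((1 + x : ℝ) : ℂ) ^ α * ∫ t in (0 : ℝ)..1, w t * H (t * -x)) atTop
      (𝓝 ((∫ t in (0 : ℝ)..1, w t * (t : ℂ) ^ (-α)) * L)) := by
  set g : ℝ → ℂ := fun x => ((1 + x : ℝ) : ℂ) ^ α * H (-x) with hg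
  have hH' : ContinuousOn (fun x : ℝ => H (-x)) (Ici 0) :=
    hH.comp (by fun_prop) fun x hx => neg_ofReal_mem_unitCutPlane hx
  have hgc : ContinuousOn g (Ici 0) := by
    refine ContinuousOn.mul (ContinuousOn.cpow (by fun_prop) continuousOn_const fun x hx => ?_) hH'
    exact ofReal_mem_slitPlane.2 (add_pos_of_pos_of_nonneg one_pos hx)
  obtain ⟨K, hK⟩ := exists_norm_le_of_tendsto_atTop hgc hL
  have integrand_eq : ∀ t x : ℝ, 0 ≤ t → 0 ≤ x → ((1 + x : ℝ) : ℂ) ^ α * (w t * H (t * -x))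
      = w t * (((1 + x) / (1 + t * x) : ℝ) : ℂ) ^ α * g (t * x) := by
    intro t x ht hx
    rw [one_add_cpow_eq_mul α ht hx, hg]
    push_cast
    ring_nf
  simp only [← intervalIntegral.integral_const_mul, ← intervalIntegral.integral_mul_const]
  refine intervalIntegral.tendsto_integral_filter_of_dominated_convergence
    (fun t => (‖w t‖ + ‖w t * (t : ℂ) ^ (-α)‖) * K) ?_ ?_ ((hw.norm.add hwα.norm).mul_const K) ?_
  · filter_upwards [eventually_ge_atTop 0] with x hx
    refine ((hw.mul_continuousOn ?_).const_mul _).def'.aestronglyMeasurable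
    refine hH.comp (by fun_prop) fun t ht => ?_
    rw [uIcc_of_le zero_le_one] at ht
    simpa using neg_ofReal_mem_unitCutPlane (mul_nonneg ht.1 hx)
  · filter_upwards [eventually_ge_atTop 0] with x hx
    refine ae_of_all _ fun t ht => ?_
    rw [uIoc_of_le zero_le_one] at ht
    rw [integrand_eq t x ht.1.le hx, norm_mul (_ * _), norm_mul (w t), norm_mul (w t),
      ← mul_one_add]
    gcongr
    · exact norm_one_add_div_cpow_le α ht.1 ht.2 hx
    · exact hK _ (mul_nonneg ht.1.le hx)
  · refine ae_of_all _ fun t ht => ?_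
    rw [uIoc_of_le zero_le_one] at ht
    have := ((tendsto_one_add_div_cpow α ht.1).const_mul (w t)).mul
      (hL.comp (tendsto_id.const_mul_atTop ht.1))
    refine this.congr' ?_
    filter_upwards [eventually_ge_atTop 0] with x hx
    exact (integrand_eq t x ht.1.le hx).symm

/-- The weight of Euler's beta integral, normalised so that its integral over `[0, 1]` is
`Γ u / Γ (u + v)`. -/
noncomputable def betaWeight (u v : ℂ) (t : ℝ) : ℂ :=
  (Gamma v)⁻¹ * ((t : ℂ) ^ (u - 1) * (1 - (t : ℂ)) ^ (v - 1))

theorem intervalIntegrable_betaWeight {u v : ℂ} (hu : 0 < u.re) (hv : 0 < v.re) :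
    IntervalIntegrable (betaWeight u v) volume 0 1 :=
  (betaIntegral_convergent hu hv).const_mul _

theorem integral_betaWeight {u v : ℂ} (hu : 0 < u.re) (hv : 0 < v.re) :
    ∫ t in (0 : ℝ)..1, betaWeight u v t = Gamma u / Gamma (u + v) := by
  have hv0 : Gamma v ≠ 0 := Gamma_ne_zero_of_re_pos hv
  have huv0 : Gamma (u + v) ≠ 0 := Gamma_ne_zero_of_re_pos (by simpa using add_pos hu hv)
  have := Gamma_mul_Gamma_eq_betaIntegral hu hv
  simp only [betaWeight, intervalIntegral.integral_const_mul]
  rw [← betaIntegral]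
  field_simp
  linear_combination -this

theorem betaWeight_mul_cpow_eqOn (u v s : ℂ) :
    EqOn (fun t : ℝ => betaWeight u v t * (t : ℂ) ^ s) (betaWeight (u + s) v) (uIoc 0 1) :=
  fun t ht => by
    rw [uIoc_of_le zero_le_one] at ht
    simp only [betaWeight]
    rw [add_sub_right_comm, cpow_add _ _ (ofReal_ne_zero.2 ht.1.ne')]
    ring

theorem intervalIntegrable_betaWeight_mul_cpow {u v s : ℂ} (hu : 0 < (u + s).re) (hv : 0 < v.re) :
    IntervalIntegrable (fun t : ℝ => betaWeight u v t * (t : ℂ) ^ s) volume 0 1 :=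
  (intervalIntegrable_betaWeight hu hv).congr (betaWeight_mul_cpow_eqOn u v s).symm

theorem integral_betaWeight_mul_cpow {u v s : ℂ} (hu : 0 < (u + s).re) (hv : 0 < v.re) :
    ∫ t in (0 : ℝ)..1, betaWeight u v t * (t : ℂ) ^ s = Gamma (u + s) / Gamma (u + v + s) := by
  rw [intervalIntegral.integral_congr_ae
      (ae_of_all _ fun t ht => betaWeight_mul_cpow_eqOn u v s ht),
    integral_betaWeight hu hv, add_right_comm]

/-- `H` is holomorphic on `ℂ ∖ [1, ∞)` with Taylor coefficients `a` at `0`, and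
`H (-x) ∼ L * x ^ (-α)` as `x → ∞`; the base `1 + x` is used since it stays positive for `x ≥ 0`. -/
structure HasPowerAsymptotics (α : ℂ) (a : ℕ → ℂ) (L : ℂ) (H : ℂ → ℂ) : Prop where
  differentiableOn : DifferentiableOn ℂ H unitCutPlane
  hasDiscSum : HasDiscSum a H
  tendsto : Tendsto (fun x : ℝ => ((1 + x : ℝ) : ℂ) ^ α * H (-x)) atTop (𝓝 L)

namespace HasPowerAsymptotics

variable {α L M : ℂ} {a b : ℕ → ℂ} {G H : ℂ → ℂ}

theorem add (hG : HasPowerAsymptotics α a L G) (hH : HasPowerAsymptotics α b M H) :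
    HasPowerAsymptotics α (fun n => a n + b n) (L + M) fun z => G z + H z where
  differentiableOn := hG.differentiableOn.add hH.differentiableOn
  hasDiscSum := hG.hasDiscSum.add hH.hasDiscSum
  tendsto := by simpa only [mul_add] using hG.tendsto.add hH.tendsto

theorem const_mul (c : ℂ) (hH : HasPowerAsymptotics α a L H) :
    HasPowerAsymptotics α (fun n => c * a n) (c * L) fun z => c * H z where
  differentiableOn := hH.differentiableOn.const_mul c
  hasDiscSum z hz := by
    simpa only [smul_eq_mul, mul_left_comm c] using (hH.hasDiscSum z hz).mul_left c
  tendsto := by simpa only [mul_left_comm c] using hH.tendsto.const_mul c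

theorem of_add_one (hH : HasPowerAsymptotics (α + 1) a L H) : HasPowerAsymptotics α a 0 H where
  differentiableOn := hH.differentiableOn
  hasDiscSum := hH.hasDiscSum
  tendsto := by
    have inv : Tendsto (fun x : ℝ => (((1 + x)⁻¹ : ℝ) : ℂ)) atTop (𝓝 ((0 : ℝ) : ℂ)) :=
      (continuous_ofReal.tendsto 0).comp <|
        tendsto_inv_atTop_zero.comp (tendsto_atTop_add_const_left _ 1 tendsto_id)
    have := hH.tendsto.mul inv
    rw [ofReal_zero, mul_zero] at this
    refine this.congr' ?_
    filter_upwards [eventually_ge_atTop 0] with x hx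
    have : ((1 + x : ℝ) : ℂ) ≠ 0 := ofReal_ne_zero.2 (by positivity)
    rw [cpow_add _ _ this, cpow_one, ofReal_inv]
    field_simp

theorem betaTransform {u v : ℂ} (hH : HasPowerAsymptotics α a L H) (hu : 0 < u.re)
    (huα : α.re < u.re) (hv : 0 < v.re) :
    HasPowerAsymptotics α (fun n => a n * (Gamma (u + n) / Gamma (u + v + n)))
      (Gamma (u - α) / Gamma (u + v - α) * L)
      fun z => ∫ t in (0 : ℝ)..1, betaWeight u v t * H (t * z) where
  differentiableOn := differentiableOn_integral_mul_comp_mul (intervalIntegrable_betaWeight hu hv)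
    isOpen_unitCutPlane starConvex_unitCutPlane hH.differentiableOn
  hasDiscSum := by
    convert hasDiscSum_integral_mul_comp_mul (intervalIntegrable_betaWeight hu hv)
      hH.hasDiscSum using 3 with n
    simp only [← cpow_natCast (_ : ℂ) n]
    rw [integral_betaWeight_mul_cpow (by simp only [add_re, natCast_re]; positivity) hv]
  tendsto := by
    have huα' : 0 < (u + -α).re := by simpa using huα
    have := tendsto_cpow_mul_integral_mul_comp_mul (intervalIntegrable_betaWeight hu hv)
      (intervalIntegrable_betaWeight_mul_cpow huα' hv) hH.differentiableOn.continuousOn hH.tendsto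
    rwa [integral_betaWeight_mul_cpow huα' hv] at this

end HasPowerAsymptotics

theorem multichoose_eq_ascPochhammer_div (α : ℂ) (n : ℕ) :
    Ring.multichoose α n = (ascPochhammer ℂ n).eval α / n.factorial := by
  rw [eq_div_iff (Nat.cast_ne_zero.2 n.factorial_ne_zero), mul_comm, ← nsmul_eq_mul,
    Ring.factorial_nsmul_multichoose_eq_ascPochhammer, ascPochhammer_smeval_eq_eval]

theorem succ_mul_multichoose_succ (α : ℂ) (n : ℕ) :
    ((n : ℂ) + 1) * Ring.multichoose α (n + 1) = (α + n) * Ring.multichoose α n := by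
  have : ((n : ℂ) + 1) ≠ 0 := n.cast_add_one_ne_zero
  rw [multichoose_eq_ascPochhammer_div, multichoose_eq_ascPochhammer_div, ascPochhammer_succ_eval,
    Nat.factorial_succ]
  push_cast
  field_simp

theorem mul_multichoose_add_one (α : ℂ) (n : ℕ) :
    α * Ring.multichoose (α + 1) n = (α + n) * Ring.multichoose α n := by
  have : α * (ascPochhammer ℂ n).eval (α + 1) = (ascPochhammer ℂ n).eval α * (α + n) := by
    rw [← ascPochhammer_succ_eval, ascPochhammer_succ_left]
    simp
  rw [multichoose_eq_ascPochhammer_div, multichoose_eq_ascPochhammer_div, ← mul_div_assoc, this]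
  ring

theorem hasPowerAsymptotics_one_sub_cpow_neg (α : ℂ) :
    HasPowerAsymptotics α (Ring.multichoose α) 1 fun z => (1 - z) ^ (-α) where
  differentiableOn := DifferentiableOn.cpow_const (by fun_prop) fun z hz => hz
  hasDiscSum z hz := by
    have := (one_div_one_sub_cpow_hasFPowerSeriesOnBall_zero α).hasSum (y := z)
      (by simpa [← ENNReal.ofReal_one, Metric.eball_ofReal] using hz)
    simpa [FormalMultilinearSeries.ofScalars_apply_eq, ← Ring.multichoose_eq, cpow_neg, mul_comm]
      using this
  tendsto := by
    refine tendsto_const_nhds.congr' ?_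
    filter_upwards [eventually_ge_atTop 0] with x hx
    have : ((1 + x : ℝ) : ℂ) ≠ 0 := ofReal_ne_zero.2 (by positivity)
    rw [sub_neg_eq_add, ← ofReal_one, ← ofReal_add, ← cpow_add _ _ this, add_neg_cancel, cpow_zero,
      ofReal_one]

theorem exists_hasPowerAsymptotics_eval_mul_multichoose (p : ℂ[X]) (α : ℂ) :
    ∃ H, HasPowerAsymptotics α (fun n => p.eval (n : ℂ) * Ring.multichoose α n)
      (p.eval (-α)) H := by
  induction p using Polynomial.induction_on generalizing α with
  | C c =>
    exact ⟨_, by simpa only [eval_C, mul_one] using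
      (hasPowerAsymptotics_one_sub_cpow_neg α).const_mul c⟩
  | add p q hp hq =>
    obtain ⟨G, hG⟩ := hp α
    obtain ⟨H, hH⟩ := hq α
    exact ⟨_, by simpa only [eval_add, add_mul] using hG.add hH⟩
  | monomial n c ih =>
    obtain ⟨G, hG⟩ := ih (α + 1)
    obtain ⟨H, hH⟩ := ih α
    -- `n (α)ₙ = α (α + 1)ₙ - α (α)ₙ`, and the first term decays faster than `x ^ (-α)`.
    refine ⟨fun z => α * G z + -α * H z, ?_⟩
    convert (hG.of_add_one.const_mul α).add (hH.const_mul (-α)) using 1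
    · funext m
      rw [pow_succ, ← mul_assoc, eval_mul_X]
      linear_combination -(C c * X ^ n).eval (m : ℂ) * mul_multichoose_add_one α m
    · rw [pow_succ, ← mul_assoc, eval_mul_X]
      ring

theorem inv_Gamma_eq_ascPochhammer_mul (s : ℂ) (m : ℕ) :
    (Gamma s)⁻¹ = (ascPochhammer ℂ m).eval s * (Gamma (s + m))⁻¹ := by
  induction m with
  | zero => simp
  | succ m ih =>
    rw [ih, one_div_Gamma_eq_self_mul_one_div_Gamma_add_one (s + m), ascPochhammer_succ_eval,
      Nat.cast_succ, add_assoc, mul_assoc]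

theorem exists_hasPowerAsymptotics_eval_mul_prod_Gamma_div {ι : Type*} {α : ℂ} (β γ : ι → ℂ)
    (s : Finset ι) (hβ : ∀ k ∈ s, 0 < (β k).re) (hαβ : ∀ k ∈ s, α.re < (β k).re) (p : ℂ[X]) :
    ∃ H, HasPowerAsymptotics α
      (fun n => p.eval (n : ℂ) * Ring.multichoose α n * ∏ k ∈ s, Gamma (β k + n) / Gamma (γ k + n))
      (p.eval (-α) * ∏ k ∈ s, Gamma (β k - α) / Gamma (γ k - α)) H := by
  classical
  induction s using Finset.induction_on generalizing p with
  | empty => simpa using exists_hasPowerAsymptotics_eval_mul_multichoose p α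
  | insert k s hk ih =>
    rw [Finset.forall_mem_insert] at hβ hαβ
    obtain ⟨m, hm⟩ := exists_nat_gt ((β k).re - (γ k).re)
    -- `1 / Γ (γ + n) = (γ + n)ₘ / Γ (γ + m + n)`, and the beta integral handles `γ + m`.
    obtain ⟨H, hH⟩ := ih hβ.2 hαβ.2 (p * (ascPochhammer ℂ m).comp (X + C (γ k)))
    have hv : 0 < (γ k + m - β k).re := by
      simp only [sub_re, add_re, natCast_re]
      linarith
    refine ⟨fun z => ∫ t in (0 : ℝ)..1, betaWeight (β k) (γ k + m - β k) t * H (t * z), ?_⟩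
    convert hH.betaTransform hβ.1 hαβ.1 hv using 1
    · funext n
      rw [Finset.prod_insert hk, add_sub_cancel, div_eq_mul_inv _ (Gamma (γ k + n)),
        inv_Gamma_eq_ascPochhammer_mul _ m, add_right_comm (γ k)]
      simp only [eval_mul, eval_comp, eval_add, eval_X, eval_C, add_comm (n : ℂ) (γ k)]
      ring
    · rw [Finset.prod_insert hk, add_sub_cancel, div_eq_mul_inv _ (Gamma (γ k - α)),
        inv_Gamma_eq_ascPochhammer_mul _ m, sub_add_eq_add_sub]
      simp only [eval_mul, eval_comp, eval_add, eval_X, eval_C, neg_add_eq_sub]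
      ring

/-! ### Functions on the cut plane -/

theorem mem_cutPlane_iff {z : ℂ} : z ∈ cutPlane ↔ -z ∈ slitPlane := by
  rw [cutPlane, mem_compl_iff, not_iff_comm, mem_slitPlane_iff]
  push Not
  simp only [neg_re, Left.neg_nonpos_iff, neg_im, neg_eq_zero, mem_image, mem_Ici]
  refine ⟨fun ⟨h0, h1⟩ => ⟨z.re, h0, Complex.ext (by simp) (by simp [h1])⟩, ?_⟩
  rintro ⟨x, hx, rfl⟩
  exact ⟨hx, ofReal_im x⟩

theorem isOpen_cutPlane : IsOpen cutPlane := by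
  have : cutPlane = (-·) ⁻¹' slitPlane := Set.ext fun _ => mem_cutPlane_iff
  exact this ▸ isOpen_slitPlane.preimage continuous_neg

theorem starConvex_cutPlane : StarConvex ℝ (-1) cutPlane := by
  intro z hz a b ha hb hab
  rw [mem_cutPlane_iff] at hz ⊢
  simpa only [smul_neg, neg_add, neg_neg] using starConvex_one_slitPlane hz ha hb hab

theorem isPreconnected_cutPlane : IsPreconnected cutPlane :=
  (starConvex_cutPlane.isPathConnected (mem_cutPlane_iff.2 (by simp))).isConnected.isPreconnected

theorem dense_cutPlane : Dense cutPlane := by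
  refine ((dense_compl_singleton (0 : ℝ)).preimage isOpenMap_im).mono fun z hz => ?_
  rw [mem_cutPlane_iff]
  exact Or.inr (by simpa using hz)

theorem neg_ofReal_mem_cutPlane {x : ℝ} (hx : 0 < x) : -(x : ℂ) ∈ cutPlane := by
  rwa [mem_cutPlane_iff, neg_neg, ofReal_mem_slitPlane]

theorem ne_zero_of_mem_cutPlane {z : ℂ} (hz : z ∈ cutPlane) : z ≠ 0 :=
  neg_ne_zero.1 (slitPlane_ne_zero (mem_cutPlane_iff.1 hz))

theorem cutPlane_subset_unitCutPlane : cutPlane ⊆ unitCutPlane := fun z hz => by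
  rw [mem_cutPlane_iff, mem_slitPlane_iff] at hz
  refine hz.imp (fun h => ?_) fun h => ?_
  · simp only [sub_re, one_re, neg_re] at h ⊢
    linarith
  · simpa using h

theorem one_sub_ne_zero_of_mem_cutPlane {z : ℂ} (hz : z ∈ cutPlane) : 1 - z ≠ 0 :=
  slitPlane_ne_zero (cutPlane_subset_unitCutPlane hz)

theorem inv_mem_cutPlane {z : ℂ} (hz : z ∈ cutPlane) : z⁻¹ ∈ cutPlane := by
  rintro ⟨x, hx, hxz⟩
  exact hz ⟨x⁻¹, mem_Ici.2 (inv_nonneg.2 hx), by simp only [ofReal_inv, hxz, inv_inv]⟩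

theorem cutPow_ne_zero (z a : ℂ) : cutPow z a ≠ 0 := exp_ne_zero _

theorem cutPow_add (z a b : ℂ) : cutPow z (a + b) = cutPow z a * cutPow z b := by
  rw [cutPow, cutPow, cutPow, ← exp_add, add_mul]

theorem cutPow_eq_mul_cpow {z : ℂ} (hz : z ∈ cutPlane) (a : ℂ) :
    cutPow z a = exp (a * (Real.pi * I)) * (-z) ^ a := by
  rw [cutPow, cpow_def_of_ne_zero (neg_ne_zero.2 (ne_zero_of_mem_cutPlane hz)), mul_add, exp_add,
    mul_comm a (log _), mul_comm]

theorem cutPow_natCast {z : ℂ} (hz : z ∈ cutPlane) (n : ℕ) : cutPow z n = z ^ n := by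
  rw [cutPow_eq_mul_cpow hz, cpow_natCast, exp_nat_mul, exp_pi_mul_I, ← mul_pow, neg_one_mul,
    neg_neg]

theorem cutPow_neg (z a : ℂ) : cutPow z (-a) = (cutPow z a)⁻¹ := by
  rw [cutPow, cutPow, neg_mul, exp_neg]

theorem cutPow_inv {z : ℂ} (hz : z ∈ cutPlane) (a : ℂ) :
    cutPow z⁻¹ a = cutPow z (-a) * exp (2 * Real.pi * I * a) := by
  rw [cutPow, cutPow, ← exp_add, ← inv_neg,
    log_inv _ (slitPlane_arg_ne_pi (mem_cutPlane_iff.1 hz))]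
  congr 1
  ring

theorem hasDerivAt_cutPow {z : ℂ} (hz : z ∈ cutPlane) (a : ℂ) :
    HasDerivAt (fun z => cutPow z a) (cutPow z a * (a * z⁻¹)) z := by
  have hlog : HasDerivAt (fun z : ℂ => log (-z)) z⁻¹ z := by
    simpa [neg_div_neg_eq] using (hasDerivAt_neg z).clog (mem_cutPlane_iff.1 hz)
  exact ((hlog.add_const _).const_mul a).cexp

section CutPlaneExpansion

variable {E : Type*} [NormedAddCommGroup E] {b c : ℕ → E} {g h : ℂ → E}

theorem eq_of_eq_on_cutPlane (hg : ContinuousOn g (Metric.ball 0 1))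
    (hh : ContinuousOn h (Metric.ball 0 1)) (hgh : ∀ z ∈ cutPlane, ‖z‖ < 1 → g z = h z) {x : ℂ}
    (hx : ‖x‖ < 1) : g x = h x := by
  exact EqOn.of_subset_closure (s := Metric.ball 0 1 ∩ cutPlane)
    (fun z hz => hgh z hz.2 (mem_ball_zero_iff.1 hz.1)) hg hh inter_subset_left
    (dense_cutPlane.open_subset_closure_inter Metric.isOpen_ball) (mem_ball_zero_iff.2 hx)

variable [NormedSpace ℂ E] [CompleteSpace E]

theorem HasDiscSum.unique_of_eq_on_cutPlane (hg : HasDiscSum b g) (hh : HasDiscSum c h)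
    (hgh : ∀ z ∈ cutPlane, ‖z‖ < 1 → g z = h z) : b = c :=
  hg.unique <| hh.congr fun _ => eq_of_eq_on_cutPlane hh.differentiableOn.continuousOn
    hg.differentiableOn.continuousOn fun z hz hz1 => (hgh z hz hz1).symm

theorem exists_hasDiscSum_of_hasSum_on_cutPlane
    (hc : ∀ z ∈ cutPlane, ‖z‖ < 1 → HasSum (fun n => z ^ n • c n) (h z)) :
    ∃ g, HasDiscSum c g ∧ ∀ z ∈ cutPlane, ‖z‖ < 1 → h z = g z := by
  obtain ⟨g, hg⟩ := exists_hasDiscSum_of_norm_mul_pow_le (c := c) fun ρ hρ0 hρ1 => by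
    have norm_ρ : ‖-(ρ : ℂ)‖ = ρ := by rw [norm_neg, norm_real, Real.norm_of_nonneg hρ0.le]
    simpa only [norm_ρ] using exists_norm_mul_pow_le_of_summable
      (hc _ (neg_ofReal_mem_cutPlane hρ0) (by rwa [norm_ρ])).summable
  exact ⟨g, hg, fun z hz hz1 => (hc z hz hz1).unique (hg z hz1)⟩

end CutPlaneExpansion

section Asymptotics

variable {ι : Type*} [Fintype ι]

/-- `F` is a holomorphic function on `ℂ ∖ [0, ∞)` that is given by `∑ Aₙ zⁿ` for `|z| < 1` and by
`∑ₗ (-z) ^ (-βₗ) * pₗ (1 / z)` for `|z| > 1`, where the `pₗ` are holomorphic on the unit disc. The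
number `C` is the leading coefficient `pᵢ 0` belonging to the exponent `βᵢ`. -/
structure HasCutPlaneExpansions (β : ι → ℂ) (i : ι) (C : ℂ) (A : ℕ → ℂ) (F : ℂ → ℂ) : Prop where
  differentiableOn : DifferentiableOn ℂ F cutPlane
  atZero : ∃ q, HasDiscSum A q ∧ ∀ z ∈ cutPlane, ‖z‖ < 1 → F z = q z
  atInfty : ∃ p : ι → ℂ → ℂ, (∀ l, DifferentiableOn ℂ (p l) (Metric.ball 0 1)) ∧ p i 0 = C ∧
    ∀ z ∈ cutPlane, 1 < ‖z‖ → F z = ∑ l, (-z) ^ (-β l) * p l z⁻¹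

theorem hasDerivAt_neg_cpow_mul_comp_inv {z : ℂ} (hz : z ∈ cutPlane) (s : ℂ) {p : ℂ → ℂ}
    (hp : DifferentiableAt ℂ p z⁻¹) :
    HasDerivAt (fun w => (-w) ^ (-s) * p w⁻¹)
      (z⁻¹ * ((-z) ^ (-s) * (-s * p z⁻¹ - z⁻¹ * deriv p z⁻¹))) z := by
  have hz0 := ne_zero_of_mem_cutPlane hz
  refine (((hasDerivAt_neg z).cpow_const (c := -s) (mem_cutPlane_iff.1 hz)).mul
    (hp.hasDerivAt.comp z (hasDerivAt_inv hz0))).congr_deriv ?_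
  rw [cpow_sub _ _ (neg_ne_zero.2 hz0), cpow_one, Function.comp_apply]
  field_simp
  ring

theorem inv_mem_ball_of_one_lt_norm {z : ℂ} (hz : 1 < ‖z‖) : z⁻¹ ∈ Metric.ball (0 : ℂ) 1 := by
  rw [mem_ball_zero_iff, norm_inv]
  exact inv_lt_one_of_one_lt₀ hz

theorem mul_deriv_eq_sum_neg_cpow_mul {β : ι → ℂ} {p : ι → ℂ → ℂ} {F : ℂ → ℂ}
    (hp : ∀ l, DifferentiableOn ℂ (p l) (Metric.ball 0 1))
    (hF : ∀ z ∈ cutPlane, 1 < ‖z‖ → F z = ∑ l, (-z) ^ (-β l) * p l z⁻¹) {z : ℂ}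
    (hz : z ∈ cutPlane) (hz1 : 1 < ‖z‖) :
    z * deriv F z = ∑ l, (-z) ^ (-β l) * (-β l * p l z⁻¹ - z⁻¹ * deriv (p l) z⁻¹) := by
  have eventually_eq : F =ᶠ[𝓝 z] fun w => ∑ l, (-w) ^ (-β l) * p l w⁻¹ := by
    filter_upwards [isOpen_cutPlane.mem_nhds hz,
      continuous_norm.continuousAt.eventually_const_lt hz1] with w hw hw1
    exact hF w hw hw1
  have hderiv := HasDerivAt.fun_sum fun l (_ : l ∈ Finset.univ) =>
    hasDerivAt_neg_cpow_mul_comp_inv hz (β l)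
      ((hp l).differentiableAt (Metric.isOpen_ball.mem_nhds (inv_mem_ball_of_one_lt_norm hz1)))
  rw [eventually_eq.deriv_eq, hderiv.deriv, ← Finset.mul_sum,
    mul_inv_cancel_left₀ (ne_zero_of_mem_cutPlane hz)]

theorem HasCutPlaneExpansions.euler_add_mul [DecidableEq ι] {β : ι → ℂ} {i l : ι} {C : ℂ}
    {A : ℕ → ℂ} {F : ℂ → ℂ} (hF : HasCutPlaneExpansions β i C A F) (hl : l ≠ i) :
    HasCutPlaneExpansions (Function.update β l (β l + 1)) i ((β l - β i) * C)
      (fun n => (n + β l) * A n) (fun z => z * deriv F z + β l * F z) where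
  differentiableOn := (differentiableOn_id.mul (hF.differentiableOn.deriv isOpen_cutPlane)).add
    (hF.differentiableOn.const_mul _)
  atZero := by
    obtain ⟨q, hq, hFq⟩ := hF.atZero
    refine ⟨fun z => z * deriv q z + β l * q z, ?_, fun z hz hz1 => ?_⟩
    · simpa [add_mul] using hq.smul_deriv.add (hq.map (β l • ContinuousLinearMap.id ℂ ℂ))
    · have : F =ᶠ[𝓝 z] q := by
        filter_upwards [isOpen_cutPlane.mem_nhds hz,
          continuous_norm.continuousAt.eventually_lt_const hz1] with w hw hw1
        exact hFq w hw hw1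
      rw [this.deriv_eq, this.eq_of_nhds]
  atInfty := by
    obtain ⟨p, hp, hpi, hFp⟩ := hF.atInfty
    -- On `(-z) ^ (-βₘ) * pₘ (1 / z)` the operator `z d/dz + βₗ` replaces `pₘ y` by
    -- `(βₗ - βₘ) * pₘ y - y * pₘ' y`, and for `m = l` the factor `-y` raises the exponent by one.
    refine ⟨fun m y => if m = l then deriv (p l) y else (β l - β m) * p m y - y * deriv (p m) y,
      fun m => ?_, by simp [hl.symm, hpi], fun z hz hz1 => ?_⟩
    · by_cases hm : m = l
      · simpa only [if_pos hm] using (hp l).deriv Metric.isOpen_ball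
      · simpa only [if_neg hm, id_eq] using
          ((hp m).const_mul _).fun_sub
            (differentiableOn_id.fun_mul ((hp m).deriv Metric.isOpen_ball))
    · have hz0 := ne_zero_of_mem_cutPlane hz
      rw [mul_deriv_eq_sum_neg_cpow_mul hp hFp hz hz1, hFp z hz hz1, Finset.mul_sum,
        ← Finset.sum_add_distrib]
      refine Finset.sum_congr rfl fun m _ => ?_
      beta_reduce
      split_ifs with hm
      · subst hm
        rw [Function.update_self, neg_add, cpow_add _ _ (neg_ne_zero.2 hz0), cpow_neg_one, inv_neg]
        ring
      · rw [Function.update_of_ne hm]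
        ring

theorem tendsto_one_add_cpow_mul_cpow_neg_self (α : ℂ) :
    Tendsto (fun x : ℝ => ((1 + x : ℝ) : ℂ) ^ α * (x : ℂ) ^ (-α)) atTop (𝓝 1) := by
  have base : Tendsto (fun x : ℝ => (((1 + x) / x : ℝ) : ℂ)) atTop (𝓝 1) := by
    have := (continuous_ofReal.tendsto _).comp (tendsto_inv_atTop_zero.const_add (1 : ℝ))
    rw [add_zero, ofReal_one] at this
    refine this.congr' ?_
    filter_upwards [eventually_gt_atTop 0] with x hx
    simp only [Function.comp_apply]
    congr 1
    field_simp
    ring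
  have := (continuousAt_cpow_const (b := α) one_mem_slitPlane).tendsto.comp base
  rw [one_cpow] at this
  refine this.congr' ?_
  filter_upwards [eventually_gt_atTop 0] with x hx
  rw [Function.comp_apply, div_eq_mul_inv, ofReal_mul,
    mul_cpow_ofReal_nonneg (by positivity) (by positivity), ofReal_inv,
    inv_cpow _ _ (by simp [arg_ofReal_of_nonneg hx.le, Real.pi_ne_zero.symm]), cpow_neg]

theorem tendsto_one_add_cpow_mul_cpow_neg {α β : ℂ} (h : α.re < β.re) :
    Tendsto (fun x : ℝ => ((1 + x : ℝ) : ℂ) ^ α * (x : ℂ) ^ (-β)) atTop (𝓝 0) := by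
  have decay : Tendsto (fun x : ℝ => (x : ℂ) ^ (α - β)) atTop (𝓝 0) := by
    rw [tendsto_zero_iff_norm_tendsto_zero]
    refine (tendsto_rpow_neg_atTop (sub_pos.2 h)).congr' ?_
    filter_upwards [eventually_gt_atTop 0] with x hx
    rw [norm_cpow_eq_rpow_re_of_pos hx, sub_re, neg_sub]
  have := (tendsto_one_add_cpow_mul_cpow_neg_self α).mul decay
  rw [mul_zero] at this
  refine this.congr' ?_
  filter_upwards [eventually_gt_atTop 0] with x hx
  rw [mul_assoc, ← cpow_add _ _ (ofReal_ne_zero.2 hx.ne'), neg_add_eq_sub, sub_sub_cancel_left]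

theorem HasCutPlaneExpansions.tendsto {β : ι → ℂ} {i : ι} {C : ℂ} {A : ℕ → ℂ} {F : ℂ → ℂ}
    (hF : HasCutPlaneExpansions β i C A F) (hβ : ∀ l ≠ i, (β i).re < (β l).re) :
    Tendsto (fun x : ℝ => ((1 + x : ℝ) : ℂ) ^ β i * F (-x)) atTop (𝓝 C) := by
  classical
  obtain ⟨p, hp, hpi, hFp⟩ := hF.atInfty
  have tendsto_p (l : ι) : Tendsto (fun x : ℝ => p l (-(x : ℂ))⁻¹) atTop (𝓝 (p l 0)) := by
    refine ((hp l).differentiableAt (Metric.ball_mem_nhds 0 one_pos)).continuousAt.tendsto.comp ?_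
    have := ((continuous_ofReal.tendsto 0).comp tendsto_inv_atTop_zero).neg
    simpa only [Function.comp_def, ofReal_inv, ofReal_zero, neg_zero, inv_neg] using this
  have tendsto_term (l : ι) : Tendsto
      (fun x : ℝ => ((1 + x : ℝ) : ℂ) ^ β i * (x : ℂ) ^ (-β l) * p l (-(x : ℂ))⁻¹) atTop
      (𝓝 (if l = i then C else 0)) := by
    split_ifs with hl
    · subst hl
      simpa only [one_mul, hpi] using (tendsto_one_add_cpow_mul_cpow_neg_self _).mul (tendsto_p l)
    · simpa only [zero_mul] using (tendsto_one_add_cpow_mul_cpow_neg (hβ l hl)).mul (tendsto_p l)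
  have := tendsto_finsetSum Finset.univ fun l _ => tendsto_term l
  rw [Finset.sum_ite_eq' Finset.univ i, if_pos (Finset.mem_univ i)] at this
  refine this.congr' ?_
  filter_upwards [eventually_gt_atTop 1] with x hx
  have hx0 : 0 < x := one_pos.trans hx
  rw [hFp _ (neg_ofReal_mem_cutPlane hx0)
      (by rwa [norm_neg, norm_real, Real.norm_of_nonneg hx0.le]),
    Finset.mul_sum]
  simp only [neg_neg, mul_assoc]

end Asymptotics

/-! ### Connection coefficients of hypergeometric series -/

section LeadingCoefficient

variable {ι : Type*} [Fintype ι] {β γ : ι → ℂ} {i : ι} {A : ℕ → ℂ}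

theorem mul_eq_mul_of_succ_mul_eq {a b : ℕ → ℂ} {r s : ℕ → ℂ} (hs : ∀ n, s n ≠ 0)
    (ha : ∀ n, a (n + 1) * s n = a n * r n) (hb : ∀ n, b (n + 1) * s n = b n * r n) (n : ℕ) :
    b 0 * a n = a 0 * b n := by
  induction n with
  | zero => exact mul_comm _ _
  | succ n ih =>
    refine mul_right_cancel₀ (hs n) ?_
    rw [mul_assoc, ha, mul_assoc, hb, ← mul_assoc, ih, mul_assoc]

theorem multichoose_mul_prod_Gamma_div_succ [DecidableEq ι] (hγ : γ i = 1)
    (hβ : ∀ k ∈ Finset.univ.erase i, 0 < (β k).re) (n : ℕ) :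
    (Ring.multichoose (β i) (n + 1) *
        ∏ k ∈ Finset.univ.erase i, Gamma (β k + (n + 1 : ℕ)) / Gamma (γ k + (n + 1 : ℕ))) *
      ∏ k, (γ k + n) =
    (Ring.multichoose (β i) n *
        ∏ k ∈ Finset.univ.erase i, Gamma (β k + n) / Gamma (γ k + n)) * ∏ k, (β k + n) := by
  have ratio : ∀ k ∈ Finset.univ.erase i,
      Gamma (β k + (n + 1 : ℕ)) / Gamma (γ k + (n + 1 : ℕ)) * (γ k + n) =
        Gamma (β k + n) / Gamma (γ k + n) * (β k + n) := by
    intro k hk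
    have : β k + n ≠ 0 := fun h => by
      have := congrArg re h
      simp only [add_re, natCast_re, zero_re] at this
      linarith [hβ k hk, n.cast_nonneg (α := ℝ)]
    rw [div_eq_mul_inv _ (Gamma (γ k + n)),
      one_div_Gamma_eq_self_mul_one_div_Gamma_add_one (γ k + n),
      Nat.cast_succ, ← add_assoc, ← add_assoc, Gamma_add_one _ this]
    ring
  have prod_ratio := Finset.prod_congr rfl ratio
  rw [Finset.prod_mul_distrib, Finset.prod_mul_distrib] at prod_ratio
  rw [← Finset.mul_prod_erase _ _ (Finset.mem_univ i), hγ,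
    ← Finset.mul_prod_erase _ (fun k => β k + (n : ℂ)) (Finset.mem_univ i)]
  linear_combination
    Ring.multichoose (β i) (n + 1) * (1 + n) * prod_ratio +
      (∏ k ∈ Finset.univ.erase i, Gamma (β k + n) / Gamma (γ k + n)) *
        (∏ k ∈ Finset.univ.erase i, (β k + n)) * succ_mul_multichoose_succ (β i) n

namespace HasCutPlaneExpansions

variable {C : ℂ} {F : ℂ → ℂ}

theorem eqOn_of_hasDiscSum (hF : HasCutPlaneExpansions β i C A F) {H : ℂ → ℂ}
    (hH : DifferentiableOn ℂ H cutPlane) {c : ℂ} (hcH : HasDiscSum (fun n => c * A n) H) :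
    EqOn (fun z => c * F z) H cutPlane := by
  obtain ⟨q, hq, hFq⟩ := hF.atZero
  have near : -((2⁻¹ : ℝ) : ℂ) ∈ cutPlane := neg_ofReal_mem_cutPlane (by norm_num)
  refine ((hF.differentiableOn.const_mul c).analyticOnNhd
    isOpen_cutPlane).eqOn_of_preconnected_of_eventuallyEq (hH.analyticOnNhd isOpen_cutPlane)
      isPreconnected_cutPlane near ?_
  have near_disc : ‖-((2⁻¹ : ℝ) : ℂ)‖ < 1 := by rw [norm_neg, norm_real]; norm_num
  filter_upwards [isOpen_cutPlane.mem_nhds near,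
    continuous_norm.continuousAt.eventually_lt_const near_disc] with z hz hz1
  rw [hFq z hz hz1]
  exact ((hq.map (c • ContinuousLinearMap.id ℂ ℂ)) z hz1).unique (hcH z hz1)

theorem mul_leadingCoeff_eq (hF : HasCutPlaneExpansions β i C A F)
    (hβ : ∀ l ≠ i, (β i).re < (β l).re) {a : ℕ → ℂ} {L : ℂ} {H : ℂ → ℂ}
    (hH : HasPowerAsymptotics (β i) a L H) {c d : ℂ} (hac : ∀ n, c * A n = d * a n) :
    c * C = d * L := by
  have eqOn := hF.eqOn_of_hasDiscSum (c := c)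
    ((hH.const_mul d).differentiableOn.mono cutPlane_subset_unitCutPlane)
    (by simpa only [hac] using (hH.const_mul d).hasDiscSum)
  refine tendsto_nhds_unique ((hF.tendsto hβ).const_mul c) ((hH.const_mul d).tendsto.congr' ?_)
  filter_upwards [eventually_gt_atTop 0] with x hx
  rw [mul_left_comm c]
  exact congrArg _ (eqOn (neg_ofReal_mem_cutPlane hx)).symm

theorem leadingCoeff_eq_of_re_lt [DecidableEq ι] (hF : HasCutPlaneExpansions β i C A F)
    (hγi : γ i = 1) (hγ : ∀ k, ∀ n : ℕ, γ k + n ≠ 0)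
    (hA : ∀ n : ℕ, A (n + 1) * ∏ k, (γ k + n) = A n * ∏ k, (β k + n))
    (hβ : ∀ l ≠ i, 0 < (β l).re) (hβi : ∀ l ≠ i, (β i).re < (β l).re) :
    C = A 0 * ∏ k ∈ Finset.univ.erase i,
      Gamma (γ k) * Gamma (β k - β i) / (Gamma (β k) * Gamma (γ k - β i)) := by
  have hβ' : ∀ k ∈ Finset.univ.erase i, 0 < (β k).re := fun k hk => hβ k (Finset.ne_of_mem_erase hk)
  obtain ⟨H, hH⟩ := exists_hasPowerAsymptotics_eval_mul_prod_Gamma_div β γ (Finset.univ.erase i)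
    hβ' (fun k hk => hβi k (Finset.ne_of_mem_erase hk)) 1
  simp only [eval_one, one_mul] at hH
  have Gamma_ne (k : ι) : Gamma (γ k) ≠ 0 :=
    Gamma_ne_zero fun m hm => hγ k m (by rw [hm, neg_add_cancel])
  have prod_ne : ∏ k ∈ Finset.univ.erase i, Gamma (β k) / Gamma (γ k) ≠ 0 :=
    Finset.prod_ne_zero_iff.2 fun k hk =>
      div_ne_zero (Gamma_ne_zero_of_re_pos (hβ' k hk)) (Gamma_ne k)
  have proportional := mul_eq_mul_of_succ_mul_eq (b := fun n => Ring.multichoose (β i) n *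
      ∏ k ∈ Finset.univ.erase i, Gamma (β k + n) / Gamma (γ k + n))
    (fun n => Finset.prod_ne_zero_iff.2 fun k _ => hγ k n) hA
    (multichoose_mul_prod_Gamma_div_succ hγi hβ')
  simp only [Ring.multichoose_zero_right, Nat.cast_zero, add_zero, one_mul] at proportional
  refine mul_left_cancel₀ prod_ne ((hF.mul_leadingCoeff_eq hβi hH proportional).trans ?_)
  rw [mul_left_comm, ← Finset.prod_mul_distrib]
  refine congrArg _ (Finset.prod_congr rfl fun k hk => ?_)
  have := Gamma_ne_zero_of_re_pos (hβ' k hk)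
  have := Gamma_ne k
  field_simp

theorem prod_Gamma_update_add_one [DecidableEq ι] {l : ι} (hl : l ≠ i) (hli : β l - β i ≠ 0) :
    β l * ∏ k ∈ Finset.univ.erase i, Gamma (γ k) * Gamma (Function.update β l (β l + 1) k - β i) /
        (Gamma (Function.update β l (β l + 1) k) * Gamma (γ k - β i)) =
      (β l - β i) * ∏ k ∈ Finset.univ.erase i,
        Gamma (γ k) * Gamma (β k - β i) / (Gamma (β k) * Gamma (γ k - β i)) := by
  have mem : l ∈ Finset.univ.erase i := Finset.mem_erase.2 ⟨hl, Finset.mem_univ l⟩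
  rw [← Finset.mul_prod_erase _ _ mem, ← Finset.mul_prod_erase _ (fun k =>
    Gamma (γ k) * Gamma (β k - β i) / (Gamma (β k) * Gamma (γ k - β i))) mem, ← mul_assoc,
    ← mul_assoc]
  congr 1
  · rw [Function.update_self, add_sub_right_comm, Gamma_add_one _ hli, div_eq_mul_inv,
      div_eq_mul_inv, mul_inv, mul_inv, one_div_Gamma_eq_self_mul_one_div_Gamma_add_one (β l)]
    ring
  · refine Finset.prod_congr rfl fun k hk => ?_
    rw [Function.update_of_ne (Finset.ne_of_mem_erase hk)]

theorem succ_add_mul_mul_prod_eq [DecidableEq ι] (l : ι) {n : ℕ}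
    (hA : A (n + 1) * ∏ k, (γ k + n) = A n * ∏ k, (β k + n)) :
    ((n + 1 : ℕ) + β l) * A (n + 1) * ∏ k, (γ k + n) =
      (n + β l) * A n * ∏ k, (Function.update β l (β l + 1) k + n) := by
  rw [mul_assoc, hA, ← Finset.mul_prod_erase _ _ (Finset.mem_univ l),
    ← Finset.mul_prod_erase _ (fun k => Function.update β l (β l + 1) k + (n : ℂ))
      (Finset.mem_univ l), Function.update_self, Finset.prod_congr rfl fun k hk => by
      rw [← Function.update_of_ne (Finset.ne_of_mem_erase hk) (β l + 1) β], Nat.cast_succ]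
  ring

theorem leadingCoeff_eq_of_lt_add_count [DecidableEq ι] (hF : HasCutPlaneExpansions β i C A F)
    (hγi : γ i = 1) (hγ : ∀ k, ∀ n : ℕ, γ k + n ≠ 0)
    (hA : ∀ n : ℕ, A (n + 1) * ∏ k, (γ k + n) = A n * ∏ k, (β k + n))
    (hβ : ∀ l ≠ i, ∀ n : ℕ, β l - β i + n ≠ 0) (m : Multiset ι)
    (hm : ∀ l ≠ i, max 0 (β i).re < (β l).re + m.count l) :
    C = A 0 * ∏ k ∈ Finset.univ.erase i,
      Gamma (γ k) * Gamma (β k - β i) / (Gamma (β k) * Gamma (γ k - β i)) := by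
  induction m using Multiset.induction_on generalizing β C A F with
  | empty =>
    simp only [Multiset.count_zero, Nat.cast_zero, add_zero, max_lt_iff] at hm
    exact hF.leadingCoeff_eq_of_re_lt hγi hγ hA (fun l hl => (hm l hl).1) fun l hl => (hm l hl).2
  | cons l m ih =>
    by_cases hl : l = i
    · exact ih hF hA hβ fun k hk => by simpa [Multiset.count_cons, hl, hk] using hm k hk
    have hli : β l - β i ≠ 0 := by simpa using hβ l hl 0
    have update_i : Function.update β l (β l + 1) i = β i := Function.update_of_ne (Ne.symm hl) _ _
    have shifted := ih (hF.euler_add_mul hl) (fun n => succ_add_mul_mul_prod_eq l (hA n))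
      (fun k hk n => ?_) fun k hk => ?_
    · refine mul_left_cancel₀ hli (shifted.trans ?_)
      rw [update_i, Nat.cast_zero, zero_add, mul_right_comm, prod_Gamma_update_add_one hl hli]
      ring
    · rw [update_i, Function.update_apply]
      split_ifs with hkl
      · have := hβ k hk (n + 1)
        rwa [hkl, Nat.cast_succ, add_comm (n : ℂ), ← add_assoc, sub_add_eq_add_sub] at this
      · exact hβ k hk n
    · have := hm k hk
      rw [Multiset.count_cons] at this
      rw [update_i, Function.update_apply]
      split_ifs at this ⊢ with hkl
      · subst hkl
        rwa [Nat.cast_succ, add_comm (m.count k : ℝ), ← add_assoc, ← one_re, ← add_re] at this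
      · exact this

theorem leadingCoeff_eq [DecidableEq ι] {i₀ : ι} (hF : HasCutPlaneExpansions β i C A F)
    (hγi : γ i₀ = 1) (hγ : ∀ k, ∀ n : ℕ, γ k + n ≠ 0)
    (hA : ∀ n : ℕ, A (n + 1) * ∏ k, (γ k + n) = A n * ∏ k, (β k + n))
    (hβ : ∀ l ≠ i, ∀ n : ℕ, β l - β i + n ≠ 0) :
    C = A 0 * ((∏ k ∈ Finset.univ.erase i₀, Gamma (γ k)) *
        (∏ l ∈ Finset.univ.erase i, Gamma (β l - β i)) /
      ((∏ l ∈ Finset.univ.erase i, Gamma (β l)) *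
        ∏ k ∈ Finset.univ.erase i₀, Gamma (γ k - β i))) := by
  choose N hN using fun l => exists_nat_gt (max 0 (β i).re - (β l).re)
  set σ := Equiv.swap i i₀
  have prod_comp_swap (g : ι → ℂ) :
      ∏ k ∈ Finset.univ.erase i, g (σ k) = ∏ k ∈ Finset.univ.erase i₀, g k :=
    Finset.prod_equiv σ (fun k => by simp [σ, Equiv.swap_apply_eq_iff]) fun _ _ => rfl
  rw [hF.leadingCoeff_eq_of_lt_add_count (γ := γ ∘ σ) (by simpa [σ] using hγi) (fun k => hγ (σ k))
    (fun n => (congrArg _ (Equiv.prod_comp σ fun k => γ k + (n : ℂ))).trans (hA n)) hβ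
    ((∑ l, N l) • Finset.univ.val) fun l _ => ?_, Finset.prod_div_distrib,
    Finset.prod_mul_distrib, Finset.prod_mul_distrib]
  · simp only [Function.comp_apply]
    rw [prod_comp_swap fun k => Gamma (γ k), prod_comp_swap fun k => Gamma (γ k - β i)]
  · have le_sum : (N l : ℝ) ≤ (∑ l, N l : ℕ) :=
      Nat.cast_le.2 (Finset.single_le_sum (fun _ _ => Nat.zero_le _) (Finset.mem_univ l))
    rw [Multiset.count_nsmul, Multiset.count_univ, mul_one]
    linarith [hN l]

end HasCutPlaneExpansions

end LeadingCoefficient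

/-! ### Rank one perturbations -/

section Determinant

variable {K E ι : Type*} [Field K] [AddCommGroup E] [Module K E]

theorem det_smul_one_sub_eq_prod [Fintype ι] {A : Module.End K E} {α : ι → K}
    (b : Module.Basis ι K E) (hb : ∀ i, A (b i) = α i • b i) (s : K) :
    LinearMap.det (s • 1 - A) = ∏ i, (s - α i) := by
  classical
  have : LinearMap.toMatrix b b (s • 1 - A) = Matrix.diagonal fun i => s - α i := by
    ext i j
    obtain rfl | hij := eq_or_ne i j
    · simp [LinearMap.toMatrix_apply, hb]
    · simp [LinearMap.toMatrix_apply, hb, hij]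
  rw [← LinearMap.det_toMatrix b, this, Matrix.det_diagonal]

theorem mul_det_add_smulRight [FiniteDimensional K E] (M : Module.End K E) (φ : E →ₗ[K] K)
    {v y : E} {κ : K} (hy : M y = κ • v) :
    κ * LinearMap.det (M + φ.smulRight v) = (κ + φ y) * LinearMap.det M := by
  obtain rfl | hκ := eq_or_ne κ 0
  · rw [zero_smul] at hy
    by_cases hM : LinearMap.det M = 0
    · rw [hM, zero_mul, mul_zero]
    · have ker : LinearMap.ker M = ⊥ := not_not.1 (LinearMap.det_eq_zero_iff_ker_ne_bot.not.1 hM)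
      rw [LinearMap.ker_eq_bot'.1 ker y hy, map_zero, add_zero, zero_mul, zero_mul]
  · have factor : M + φ.smulRight v = M * LinearMap.transvection φ (κ⁻¹ • y) := by
      ext x
      simp [LinearMap.transvection.apply, hy, hκ]
    rw [factor, map_mul, LinearMap.transvection.det, map_smul, smul_eq_mul]
    field_simp

end Determinant

/-- The vectors `x i` are eigenvectors of `A`, normalised by `φ (x i) = 1`, for distinct
eigenvalues `α i`, no two of which differ by a positive integer. This is
`IsNormalizedEigensystem` without the condition on the vector `v`. -/
structure IsNonresonantEigensystem {N : ℕ} (φ : V N →ₗ[ℂ] ℂ) (A : Module.End ℂ (V N))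
    (α : Fin N → ℂ) (x : Fin N → V N) : Prop where
  apply_eq : ∀ i, A (x i) = α i • x i
  distinct : Function.Injective α
  nonresonant : ∀ i k, ∀ n : ℕ, 0 < n → α i - α k ≠ (n : ℂ)
  normalized : ∀ i, φ (x i) = 1

namespace IsNonresonantEigensystem

variable {N : ℕ} {φ : V N →ₗ[ℂ] ℂ} {A : Module.End ℂ (V N)} {α : Fin N → ℂ} {x : Fin N → V N}

theorem linearIndependent (h : IsNonresonantEigensystem φ A α x) : LinearIndependent ℂ x := by
  refine Module.End.eigenvectors_linearIndependent' A α h.distinct x fun i =>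
    Module.End.hasEigenvector_iff.2 ⟨Module.End.mem_eigenspace_iff.2 (h.apply_eq i), fun h0 => ?_⟩
  have := h.normalized i
  rw [h0, map_zero] at this
  exact zero_ne_one this

theorem exists_basis (h : IsNonresonantEigensystem φ A α x) :
    ∃ b : Module.Basis (Fin N) ℂ (V N), ⇑b = x :=
  ⟨basisOfLinearIndependentOfCardEqFinrank' x h.linearIndependent (by simp), by simp⟩

theorem det_smul_one_sub (h : IsNonresonantEigensystem φ A α x) (s : ℂ) :
    LinearMap.det (s • 1 - A) = ∏ i, (s - α i) := by
  obtain ⟨b, rfl⟩ := h.exists_basis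
  exact det_smul_one_sub_eq_prod b h.apply_eq s

theorem sub_add_natCast_ne_zero (h : IsNonresonantEigensystem φ A α x) {i k : Fin N} {n : ℕ}
    (hn : i ≠ k ∨ n ≠ 0) : α i - α k + n ≠ 0 := fun h0 => by
  obtain rfl | hn0 := n.eq_zero_or_pos
  · rw [Nat.cast_zero, add_zero, sub_eq_zero] at h0
    exact hn.elim (h.distinct.ne · h0) (· rfl)
  · exact h.nonresonant k i n hn0 (by linear_combination -h0)

theorem surjective_natCast_smul_sub (h : IsNonresonantEigensystem φ A α x) (i : Fin N) {n : ℕ}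
    (hn : n ≠ 0) : Function.Surjective fun y => (n : ℂ) • y - (A y - α i • y) := by
  have det_ne : LinearMap.det ((α i + n) • 1 - A) ≠ 0 := by
    rw [h.det_smul_one_sub]
    refine Finset.prod_ne_zero_iff.2 fun k _ => ?_
    rw [add_sub_right_comm]
    exact h.sub_add_natCast_ne_zero (.inr hn)
  have bijective := (Module.End.isUnit_iff _).1
    ((LinearMap.isUnit_iff_isUnit_det _).2 det_ne.isUnit)
  convert bijective.surjective using 2 with y
  simp only [LinearMap.sub_apply, LinearMap.smul_apply, Module.End.one_apply]
  module

end IsNonresonantEigensystem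

/-! ### Solutions of the differential equation -/

theorem bddAbove_range_of_le_max {u : ℕ → ℝ} {n₀ : ℕ}
    (hu : ∀ n, n₀ ≤ n → u (n + 2) ≤ max (u n) (u (n + 1))) : BddAbove (range u) := by
  obtain ⟨B, hB⟩ := ((Finset.range (n₀ + 2)).image u).bddAbove
  refine ⟨B, forall_mem_range.2 fun n => ?_⟩
  induction n using Nat.strong_induction_on with
  | _ n ih =>
    by_cases hn : n < n₀ + 2
    · exact hB (Finset.mem_coe.2 (Finset.mem_image_of_mem u (Finset.mem_range.2 hn)))
    · obtain ⟨m, rfl⟩ : ∃ m, n = m + 2 := ⟨n - 2, by lia⟩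
      exact (hu m (by lia)).trans (max_le (ih m (by lia)) (ih (m + 1) (by lia)))

section Frobenius

variable {E : Type*} [NormedAddCommGroup E] [NormedSpace ℂ E] {T C Q : E →L[ℂ] E} {g : ℕ → E}

/-- The recursion for the coefficients of a power series solution `g` of
`θ g - T g = x C g + x² (θ g + T g)`, where `θ = x d/dx`. -/
def IsThreeTermRecursion (T C : E →L[ℂ] E) (g : ℕ → E) : Prop :=
  ∀ n : ℕ, (n : ℂ) • g n - T (g n) = shiftCoeff (fun k => C (g k)) n +
    shiftCoeff (shiftCoeff fun k => (k : ℂ) • g k + T (g k)) n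

theorem exists_isThreeTermRecursion
    (hT : ∀ n : ℕ, n ≠ 0 → Function.Surjective fun y => (n : ℂ) • y - T y) {ξ : E}
    (hξ : T ξ = 0) (C : E →L[ℂ] E) : ∃ g, g 0 = ξ ∧ IsThreeTermRecursion T C g := by
  choose solve hsolve using fun n : ℕ => hT (n + 1) n.succ_ne_zero
  let next (n : ℕ) (p : E × E) : E := solve n (C p.2 + (((n : ℂ) - 1) • p.1 + T p.1))
  let s (n : ℕ) : E × E := n.rec (0, ξ) fun n p => (p.2, next n p)
  refine ⟨fun n => (s n).2, rfl, fun n => ?_⟩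
  match n with
  | 0 => simp [s, shiftCoeff, hξ]
  | 1 => simpa [s, next, shiftCoeff] using hsolve 0 (C ξ + (((0 : ℕ) - 1 : ℂ) • 0 + T 0))
  | n + 2 =>
    refine (hsolve (n + 1)
      (C (s (n + 1)).2 + ((((n + 1 : ℕ) : ℂ) - 1) • (s n).2 + T (s n).2))).trans ?_
    rw [Nat.cast_succ, add_sub_cancel_right]
    rfl

namespace IsThreeTermRecursion

theorem norm_le (hg : IsThreeTermRecursion T C g) (n : ℕ) :
    (n + 2 - ‖T‖) * ‖g (n + 2)‖ ≤ (n + ‖T‖) * ‖g n‖ + ‖C‖ * ‖g (n + 1)‖ := by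
  have norm_natCast_smul (k : ℕ) (y : E) : ‖(k : ℂ) • y‖ = k * ‖y‖ := by
    rw [norm_smul, norm_natCast]
  calc (n + 2 - ‖T‖) * ‖g (n + 2)‖
      = ‖((n + 2 : ℕ) : ℂ) • g (n + 2)‖ - ‖T‖ * ‖g (n + 2)‖ := by
        rw [norm_natCast_smul]
        push_cast
        ring
    _ ≤ ‖((n + 2 : ℕ) : ℂ) • g (n + 2)‖ - ‖T (g (n + 2))‖ := by gcongr; exact T.le_opNorm _
    _ ≤ ‖C (g (n + 1)) + ((n : ℂ) • g n + T (g n))‖ := by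
        exact (norm_sub_norm_le _ _).trans_eq (congrArg norm (hg (n + 2)))
    _ ≤ ‖C‖ * ‖g (n + 1)‖ + (n * ‖g n‖ + ‖T‖ * ‖g n‖) := by
        refine norm_add_le_of_le (C.le_opNorm _) (norm_add_le_of_le ?_ (T.le_opNorm _))
        rw [norm_natCast_smul]
    _ = (n + ‖T‖) * ‖g n‖ + ‖C‖ * ‖g (n + 1)‖ := by ring

theorem exists_forall_le_max (hg : IsThreeTermRecursion T C g) {ρ : ℝ} (hρ0 : 0 < ρ)
    (hρ1 : ρ < 1) : ∃ n₀, ∀ n, n₀ ≤ n → ‖g (n + 2)‖ * ρ ^ (n + 2) ≤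
      max (‖g n‖ * ρ ^ n) (‖g (n + 1)‖ * ρ ^ (n + 1)) := by
  have hρ : 0 < 1 - ρ ^ 2 := by nlinarith
  obtain ⟨n₀, hn₀⟩ := exists_nat_gt
    (max ‖T‖ ((‖T‖ * ρ ^ 2 + ‖C‖ * ρ + ‖T‖) / (1 - ρ ^ 2)))
  refine ⟨n₀, fun n hn => ?_⟩
  obtain ⟨norm_lt, div_lt⟩ := max_lt_iff.1 (hn₀.trans_le (Nat.cast_le.2 hn))
  rw [div_lt_iff₀ hρ] at div_lt
  set B := max (‖g n‖ * ρ ^ n) (‖g (n + 1)‖ * ρ ^ (n + 1))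
  have : 0 ≤ B := le_max_of_le_left (by positivity)
  refine le_of_mul_le_mul_left (a := n + 2 - ‖T‖) ?_ (by linarith)
  calc (n + 2 - ‖T‖) * (‖g (n + 2)‖ * ρ ^ (n + 2))
      = (n + 2 - ‖T‖) * ‖g (n + 2)‖ * ρ ^ (n + 2) := by ring
    _ ≤ ((n + ‖T‖) * ‖g n‖ + ‖C‖ * ‖g (n + 1)‖) * ρ ^ (n + 2) := by gcongr; exact hg.norm_le n
    _ = (n + ‖T‖) * ρ ^ 2 * (‖g n‖ * ρ ^ n) + ‖C‖ * ρ * (‖g (n + 1)‖ * ρ ^ (n + 1)) := by ring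
    _ ≤ (n + ‖T‖) * ρ ^ 2 * B + ‖C‖ * ρ * B := by
        gcongr
        exacts [le_max_left _ _, le_max_right _ _]
    _ = ((n + ‖T‖) * ρ ^ 2 + ‖C‖ * ρ) * B := by ring
    _ ≤ (n + 2 - ‖T‖) * B := by gcongr; linarith

theorem exists_hasDiscSum [CompleteSpace E] (hg : IsThreeTermRecursion T C g) :
    ∃ G, HasDiscSum g G := by
  refine exists_hasDiscSum_of_norm_mul_pow_le fun ρ hρ0 hρ1 => ?_
  obtain ⟨n₀, hn₀⟩ := hg.exists_forall_le_max hρ0 hρ1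
  obtain ⟨B, hB⟩ := bddAbove_range_of_le_max (u := fun n => ‖g n‖ * ρ ^ n) hn₀
  exact ⟨B, fun n => hB ⟨n, rfl⟩⟩

theorem smul_deriv_sub_eq [CompleteSpace E] (hg : IsThreeTermRecursion T C g) {G : ℂ → E}
    (hG : HasDiscSum g G) {x : ℂ} (hx : ‖x‖ < 1) :
    x • deriv G x - T (G x) = x • C (G x) + x • x • (x • deriv G x + T (G x)) :=
  ((hG.smul_deriv.sub (hG.map T)) x hx).unique <|
    ((((hG.map C).smul_shift).add ((hG.smul_deriv.add (hG.map T)).smul_shift.smul_shift))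
      x hx).congr_fun fun n => congrArg _ (hg n)

end IsThreeTermRecursion

/-- `G` solves on the unit disc the equation into which the substitution `x = 4 t / (1 + t) ^ 2`
transforms `dG/dx = T G / x + Q G / (1 - x)`. -/
def IsKoebeSolution (T Q : E →L[ℂ] E) (G : ℂ → E) : Prop :=
  DifferentiableOn ℂ G (Metric.ball 0 1) ∧ ∀ t : ℂ, ‖t‖ < 1 →
    (t * (1 - t ^ 2)) • deriv G t = (1 - t) ^ 2 • T (G t) + (4 * t) • Q (G t)

theorem exists_isKoebeSolution [CompleteSpace E] (Q : E →L[ℂ] E)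
    (hT : ∀ n : ℕ, n ≠ 0 → Function.Surjective fun y => (n : ℂ) • y - T y) {ξ : E}
    (hξ : T ξ = 0) : ∃ G, G 0 = ξ ∧ IsKoebeSolution T Q G := by
  obtain ⟨g, hg0, hg⟩ := exists_isThreeTermRecursion hT hξ ((4 : ℂ) • Q - (2 : ℂ) • T)
  obtain ⟨G, hG⟩ := hg.exists_hasDiscSum
  refine ⟨G, hG.apply_zero.trans hg0, hG.differentiableOn, fun t ht => ?_⟩
  have := hg.smul_deriv_sub_eq hG ht
  simp only [sub_apply, smul_apply] at this
  rw [← sub_eq_zero] at this ⊢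
  linear_combination (norm := module) this

end Frobenius

/-- The branch of `√(1 - z)` with positive real part. -/
noncomputable def koebeRoot (z : ℂ) : ℂ := (1 - z) ^ (2⁻¹ : ℂ)

/-- The inverse of the map `t ↦ 4 t / (1 + t) ^ 2` from the unit disc onto `ℂ ∖ [1, ∞)`. -/
noncomputable def koebeInv (z : ℂ) : ℂ := (1 - koebeRoot z) / (1 + koebeRoot z)

theorem koebeRoot_sq (z : ℂ) : koebeRoot z ^ 2 = 1 - z := cpow_ofNat_inv_pow _ 2

section KoebeInverse

variable {z : ℂ} (hz : z ∈ unitCutPlane)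
include hz

theorem koebeRoot_re_pos : 0 < (koebeRoot z).re := by
  have arg_lt := (arg_le_pi (1 - z)).lt_of_ne (slitPlane_arg_ne_pi hz)
  have lt_arg := neg_pi_lt_arg (1 - z)
  have im_eq : (log (1 - z) * 2⁻¹).im = (1 - z).arg / 2 := by
    rw [← div_eq_mul_inv, div_ofNat_im, log_im]
  rw [koebeRoot, cpow_def_of_ne_zero (slitPlane_ne_zero hz), exp_re, im_eq]
  exact mul_pos (Real.exp_pos _) (Real.cos_pos_of_mem_Ioo ⟨by linarith, by linarith⟩)

theorem koebeRoot_ne_zero : koebeRoot z ≠ 0 := by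
  intro h
  simpa [h] using koebeRoot_re_pos hz

theorem one_add_koebeRoot_ne_zero : 1 + koebeRoot z ≠ 0 := by
  intro h
  have := congrArg re h
  rw [add_re, one_re, zero_re] at this
  linarith [koebeRoot_re_pos hz]

theorem norm_koebeInv_lt_one : ‖koebeInv z‖ < 1 := by
  rw [koebeInv, norm_div, div_lt_one (norm_pos_iff.2 (one_add_koebeRoot_ne_zero hz)),
    ← sq_lt_sq₀ (norm_nonneg _) (norm_nonneg _), ← normSq_eq_norm_sq, ← normSq_eq_norm_sq,
    normSq_apply, normSq_apply]
  simp only [sub_re, one_re, sub_im, one_im, add_re, add_im]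
  nlinarith [koebeRoot_re_pos hz]

theorem hasDerivAt_koebeRoot : HasDerivAt koebeRoot (-(2 * koebeRoot z)⁻¹) z := by
  refine (((hasDerivAt_id z).const_sub 1).cpow_const hz).congr_deriv ?_
  rw [id_eq, cpow_sub _ _ (slitPlane_ne_zero hz), cpow_one, ← koebeRoot, ← koebeRoot_sq]
  have := koebeRoot_ne_zero hz
  field_simp

theorem hasDerivAt_koebeInv :
    HasDerivAt koebeInv (koebeRoot z * (1 + koebeRoot z) ^ 2)⁻¹ z := by
  have root_ne_zero := koebeRoot_ne_zero hz
  have one_add_ne_zero := one_add_koebeRoot_ne_zero hz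
  have hroot := hasDerivAt_koebeRoot hz
  refine ((hroot.const_sub 1).div (hroot.const_add 1) one_add_ne_zero).congr_deriv ?_
  field_simp
  ring

theorem koebeInv_mul_one_sub_sq : koebeInv z * (1 - koebeInv z ^ 2) =
    4 * koebeRoot z * (1 - koebeRoot z) / (1 + koebeRoot z) ^ 3 := by
  have one_add_ne_zero := one_add_koebeRoot_ne_zero hz
  rw [koebeInv]
  field_simp
  ring

end KoebeInverse

theorem koebeInv_zero : koebeInv 0 = 0 := by simp [koebeInv, koebeRoot]

namespace IsKoebeSolution

variable {E : Type*} [NormedAddCommGroup E] [NormedSpace ℂ E] {T Q : E →L[ℂ] E} {G : ℂ → E}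

theorem differentiableAt_koebeInv (hG : IsKoebeSolution T Q G) {z : ℂ} (hz : z ∈ unitCutPlane) :
    DifferentiableAt ℂ G (koebeInv z) :=
  hG.1.differentiableAt
    (Metric.isOpen_ball.mem_nhds (mem_ball_zero_iff.2 (norm_koebeInv_lt_one hz)))

theorem hasDerivAt_comp_koebeInv (hG : IsKoebeSolution T Q G) {z : ℂ} (hz : z ∈ unitCutPlane)
    (hz0 : z ≠ 0) : HasDerivAt (fun z => G (koebeInv z))
      (z⁻¹ • T (G (koebeInv z)) + (1 - z)⁻¹ • Q (G (koebeInv z))) z := by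
  refine ((hG.differentiableAt_koebeInv hz).hasDerivAt.scomp z
    (hasDerivAt_koebeInv hz)).congr_deriv ?_
  have equation := hG.2 _ (norm_koebeInv_lt_one hz)
  have root_ne_zero := koebeRoot_ne_zero hz
  have one_add_ne_zero := one_add_koebeRoot_ne_zero hz
  have z_eq : z = (1 - koebeRoot z) * (1 + koebeRoot z) := by
    linear_combination koebeRoot_sq z
  have one_sub_ne_zero : 1 - koebeRoot z ≠ 0 := left_ne_zero_of_mul (z_eq ▸ hz0)
  have coeff_eq := koebeInv_mul_one_sub_sq hz
  have coeff_ne_zero : koebeInv z * (1 - koebeInv z ^ 2) ≠ 0 := by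
    rw [coeff_eq]
    simp [root_ne_zero, one_add_ne_zero, one_sub_ne_zero]
  have coeff_T : (koebeRoot z * (1 + koebeRoot z) ^ 2)⁻¹ * (1 - koebeInv z) ^ 2 =
      koebeInv z * (1 - koebeInv z ^ 2) * z⁻¹ := by
    rw [coeff_eq, congrArg Inv.inv z_eq, koebeInv]
    field_simp
    ring
  have coeff_Q : (koebeRoot z * (1 + koebeRoot z) ^ 2)⁻¹ * (4 * koebeInv z) =
      koebeInv z * (1 - koebeInv z ^ 2) * (1 - z)⁻¹ := by
    rw [coeff_eq, ← koebeRoot_sq z, koebeInv]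
    field_simp
  refine smul_right_injective E coeff_ne_zero ?_
  dsimp only
  rw [smul_comm, equation, smul_add, smul_add, smul_smul, smul_smul, smul_smul, smul_smul,
    coeff_T, coeff_Q]

theorem exists_hasDiscSum_comp_koebeInv [CompleteSpace E] (hG : IsKoebeSolution T Q G) :
    ∃ a, HasDiscSum a fun z => G (koebeInv z) :=
  exists_hasDiscSum_of_differentiableOn fun _ hz =>
    ((hG.differentiableAt_koebeInv (ball_subset_unitCutPlane hz)).comp _
      (hasDerivAt_koebeInv (ball_subset_unitCutPlane hz)).differentiableAt).differentiableWithinAt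

end IsKoebeSolution

section Existence

variable {N : ℕ} {P Q : Module.End ℂ (V N)} {lam : ℂ} {ξ : V N}

theorem exists_isSolutionAtZero (Q : Module.End ℂ (V N)) (hξ : P ξ = lam • ξ)
    (hP : ∀ n : ℕ, n ≠ 0 → Function.Surjective fun y => (n : ℂ) • y - (P y - lam • y)) :
    ∃ f, IsSolutionAtZero P Q lam ξ f := by
  obtain ⟨G, hG0, hG⟩ := exists_isKoebeSolution (T := LinearMap.toContinuousLinearMap (P - lam • 1))
    (LinearMap.toContinuousLinearMap Q) hP (sub_eq_zero.2 hξ)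
  obtain ⟨a, ha⟩ := hG.exists_hasDiscSum_comp_koebeInv
  refine ⟨fun z => cutPow z lam • G (koebeInv z), fun z hz => ?_, a, ?_, fun z hz hz1 => ?_⟩
  · refine ((hasDerivAt_cutPow hz lam).smul (hG.hasDerivAt_comp_koebeInv
      (cutPlane_subset_unitCutPlane hz) (ne_zero_of_mem_cutPlane hz))).congr_deriv ?_
    simp only [LinearMap.coe_toContinuousLinearMap', LinearMap.sub_apply, LinearMap.smul_apply,
      Module.End.one_apply, map_smul]
    module
  · rw [← ha.apply_zero, koebeInv_zero, hG0]
  · refine ((ha z hz1).const_smul (cutPow z lam)).congr_fun fun n => ?_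
    rw [cutPow_add, cutPow_natCast hz, mul_smul]

theorem IsSolution.const_smul_comp_inv {f : ℂ → V N} (hf : IsSolution (Q - P) Q f) (c : ℂ) :
    IsSolution P Q fun z => c • f z⁻¹ := by
  intro z hz
  have z_ne_zero := ne_zero_of_mem_cutPlane hz
  have z_sub_one_ne_zero : z - 1 ≠ 0 := by
    rw [← neg_sub, neg_ne_zero]
    exact one_sub_ne_zero_of_mem_cutPlane hz
  refine (((hf _ (inv_mem_cutPlane hz)).scomp z (hasDerivAt_inv z_ne_zero)).const_smul
    c).congr_deriv ?_
  have partial_fractions : (1 - z)⁻¹ = -((z ^ 2)⁻¹ * z) - (z ^ 2)⁻¹ * (1 - z⁻¹)⁻¹ := by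
    rw [← neg_sub, show 1 - z⁻¹ = (z - 1) / z by field_simp]
    field_simp
    ring
  simp only [map_smul, LinearMap.sub_apply, inv_inv, partial_fractions]
  match_scalars
  all_goals field_simp
  ring

theorem IsSolutionAtZero.comp_inv {mu : ℂ} {ζ : V N} {f : ℂ → V N}
    (hf : IsSolutionAtZero (Q - P) Q (-mu) ζ f) :
    IsSolutionAtInfty P Q mu ζ fun z => exp (2 * Real.pi * I * mu) • f z⁻¹ := by
  obtain ⟨hsol, a, ha0, ha⟩ := hf
  refine ⟨hsol.const_smul_comp_inv _, a, ha0, fun z hz hz1 => ?_⟩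
  refine ((ha _ (inv_mem_cutPlane hz) (mem_ball_zero_iff.1
    (inv_mem_ball_of_one_lt_norm hz1))).const_smul _).congr_fun fun n => ?_
  have exp_mul_exp : exp (2 * Real.pi * I * mu) * exp (2 * Real.pi * I * (-mu + n)) = 1 := by
    rw [← exp_add, ← exp_nat_mul_two_pi_mul_I n]
    congr 1
    ring
  rw [cutPow_inv hz, smul_smul, mul_left_comm, exp_mul_exp, mul_one, neg_add, neg_neg,
    ← sub_eq_add_neg]

end Existence

theorem eqOn_zero_of_hasDerivAt_clm_apply {𝕜 E : Type*} [NontriviallyNormedField 𝕜]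
    [NormedAddCommGroup E] [NormedSpace 𝕜 E] [NormedSpace ℝ E] {a b : ℝ} {A : ℝ → E →L[𝕜] E}
    {y : ℝ → E} (hA : ContinuousOn A (Icc a b))
    (hy : ∀ t ∈ Icc a b, HasDerivAt y (A t (y t)) t) (hya : y a = 0) :
    EqOn y 0 (Icc a b) := by
  obtain ⟨B, hB⟩ := isCompact_Icc.exists_bound_of_continuousOn hA
  refine ODE_solution_unique_of_mem_Icc_right (v := fun t x => A t x) (s := fun _ => univ)
    (K := B.toNNReal) (fun t ht => ?_) (fun t ht => (hy t ht).continuousAt.continuousWithinAt)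
    (fun t ht => (hy t (Ico_subset_Icc_self ht)).hasDerivWithinAt) (fun _ _ => mem_univ _)
    continuousOn_const (fun t _ => ?_) (fun _ _ => mem_univ _) hya
  · exact ((A t).lipschitz.weaken <| NNReal.coe_le_coe.1 <|
      (hB t (Ico_subset_Icc_self ht)).trans (Real.le_coe_toNNReal B)).lipschitzOnWith
  · simpa using! hasDerivWithinAt_const t (Ici t) (0 : E)

section Transport

variable {N : ℕ} {P Q : Module.End ℂ (V N)} {f : ℂ → V N} {h : Fin N → ℂ → V N}

theorem IsSolution.zero : IsSolution P Q 0 := fun z _ => by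
  simp

theorem IsSolution.sub_sum (hf : IsSolution P Q f) (hh : ∀ j, IsSolution P Q (h j))
    (c : Fin N → ℂ) : IsSolution P Q fun z => f z - ∑ j, c j • h j z := by
  intro z hz
  refine ((hf z hz).sub (HasDerivAt.fun_sum fun j (_ : j ∈ Finset.univ) =>
    (hh j z hz).const_smul (c j))).congr_deriv ?_
  simp only [map_sub, map_sum, map_smul, smul_sub, Finset.smul_sum, smul_add,
    Finset.sum_add_distrib, smul_comm (c _)]
  abel

theorem IsSolution.eq_zero (hf : IsSolution P Q f) (h0 : f (-1) = 0) {z : ℂ} (hz : z ∈ cutPlane) :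
    f z = 0 := by
  let path : ℝ → ℂ := AffineMap.lineMap (-1) z
  have path_mem (t) (ht : t ∈ Icc (0 : ℝ) 1) : path t ∈ cutPlane :=
    starConvex_cutPlane.segment_subset hz (lineMap_mem_segment ℝ (-1) z ht)
  have continuous_path : Continuous path := AffineMap.lineMap_continuous
  have continuousOn_inv : ContinuousOn (fun t => (path t)⁻¹) (Icc 0 1) :=
    continuous_path.continuousOn.inv₀ fun t ht => ne_zero_of_mem_cutPlane (path_mem t ht)
  have continuousOn_one_sub_inv : ContinuousOn (fun t => (1 - path t)⁻¹) (Icc 0 1) :=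
    (continuous_const.sub continuous_path).continuousOn.inv₀ fun t ht =>
      one_sub_ne_zero_of_mem_cutPlane (path_mem t ht)
  have := eqOn_zero_of_hasDerivAt_clm_apply (y := fun t => f (path t))
    (A := fun t => (z - -1) • ((path t)⁻¹ • LinearMap.toContinuousLinearMap P +
      (1 - path t)⁻¹ • LinearMap.toContinuousLinearMap Q)) (by fun_prop)
    (fun t ht => (hf _ (path_mem t ht)).scomp t AffineMap.hasDerivAt_lineMap)
    (by simpa [path] using h0) (right_mem_Icc.2 zero_le_one)
  simpa [path] using this

theorem exists_eq_sum_smul (hf : IsSolution P Q f) (hh : ∀ j, IsSolution P Q (h j))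
    (hind : ∀ c : Fin N → ℂ, (∀ z ∈ cutPlane, ∑ j, c j • h j z = 0) → c = 0) :
    ∃ c : Fin N → ℂ, ∀ z ∈ cutPlane, f z = ∑ j, c j • h j z := by
  have linearIndependent : LinearIndependent ℂ fun j => h j (-1) := by
    refine Fintype.linearIndependent_iff.2 fun c hc => congrFun (hind c fun z hz => ?_)
    simpa using (IsSolution.zero.sub_sum hh c).eq_zero (by simp [hc]) hz
  let b := basisOfLinearIndependentOfCardEqFinrank' _ linearIndependent (by simp)
  refine ⟨b.repr (f (-1)), fun z hz => sub_eq_zero.1 ?_⟩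
  refine (hf.sub_sum hh _).eq_zero (sub_eq_zero.2 ?_) hz
  simpa [b] using (b.sum_repr (f (-1))).symm

end Transport

section LocalExpansions

variable {N : ℕ} {P Q : Module.End ℂ (V N)} {lam mu : ℂ} {ξ ζ : V N} {f g h : ℂ → V N}

theorem IsSolutionAtZero.exists_hasDiscSum (hf : IsSolutionAtZero P Q lam ξ f) :
    ∃ a g, a 0 = ξ ∧ HasDiscSum a g ∧ ∀ z ∈ cutPlane, ‖z‖ < 1 → f z = cutPow z lam • g z := by
  obtain ⟨-, a, ha0, ha⟩ := hf
  obtain ⟨g, hg, hfg⟩ := exists_hasDiscSum_of_hasSum_on_cutPlane (c := a)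
    (h := fun z => cutPow z (-lam) • f z) fun z hz hz1 =>
      ((ha z hz hz1).const_smul _).congr_fun fun n => by
        rw [smul_smul, ← cutPow_add, neg_add_cancel_left, cutPow_natCast hz]
  refine ⟨a, g, ha0, hg, fun z hz hz1 => ?_⟩
  rw [← hfg z hz hz1, cutPow_neg, smul_inv_smul₀ (cutPow_ne_zero z _)]

theorem IsSolutionAtInfty.exists_hasDiscSum (hh : IsSolutionAtInfty P Q mu ζ h) :
    ∃ b r, b 0 = ζ ∧ HasDiscSum b r ∧
      ∀ z ∈ cutPlane, 1 < ‖z‖ → h z = cutPow z mu • r z⁻¹ := by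
  obtain ⟨-, b, hb0, hb⟩ := hh
  obtain ⟨r, hr, hhr⟩ := exists_hasDiscSum_of_hasSum_on_cutPlane (c := b)
    (h := fun w => cutPow w⁻¹ (-mu) • h w⁻¹) fun w hw hw1 => by
      have norm_inv_gt : 1 < ‖w⁻¹‖ := by
        rw [norm_inv]
        exact (one_lt_inv₀ (norm_pos_iff.2 (ne_zero_of_mem_cutPlane hw))).2 hw1
      refine ((hb _ (inv_mem_cutPlane hw) norm_inv_gt).const_smul _).congr_fun fun n => ?_
      rw [smul_smul, ← cutPow_add, sub_eq_add_neg, neg_add_cancel_left, cutPow_neg,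
        cutPow_natCast (inv_mem_cutPlane hw), inv_pow, inv_inv]
  refine ⟨b, r, hb0, hr, fun z hz hz1 => ?_⟩
  rw [← hhr _ (inv_mem_cutPlane hz) (mem_ball_zero_iff.1 (inv_mem_ball_of_one_lt_norm hz1)),
    inv_inv, cutPow_neg, smul_inv_smul₀ (cutPow_ne_zero z _)]

theorem IsSolution.smul_deriv_eq (hf : IsSolution P Q f)
    (hg : DifferentiableOn ℂ g (Metric.ball 0 1))
    (hfg : ∀ z ∈ cutPlane, ‖z‖ < 1 → f z = cutPow z lam • g z) {z : ℂ} (hz : z ∈ cutPlane)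
    (hz1 : ‖z‖ < 1) :
    z • deriv g z = P (g z) - lam • g z + z • (1 - z)⁻¹ • Q (g z) := by
  have eventually_eq : f =ᶠ[𝓝 z] fun w => cutPow w lam • g w := by
    filter_upwards [isOpen_cutPlane.mem_nhds hz,
      continuous_norm.continuousAt.eventually_lt_const hz1] with w hw hw1
    exact hfg w hw hw1
  have hderiv := (hasDerivAt_cutPow hz lam).smul
    (hg.hasDerivAt (Metric.isOpen_ball.mem_nhds (mem_ball_zero_iff.2 hz1)))
  have := (hderiv.congr_of_eventuallyEq eventually_eq).unique (hf z hz)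
  rw [hfg z hz hz1, map_smul, map_smul, smul_comm _ (cutPow z lam), smul_comm _ (cutPow z lam),
    mul_smul, ← smul_add, ← smul_add] at this
  have equation : deriv g z = z⁻¹ • (P (g z) - lam • g z) + (1 - z)⁻¹ • Q (g z) := by
    linear_combination (norm := module) smul_right_injective (V N) (cutPow_ne_zero z lam) this
  rw [equation, smul_add, smul_inv_smul₀ (ne_zero_of_mem_cutPlane hz)]

end LocalExpansions

section RankOne

variable {N : ℕ} {P Q : Module.End ℂ (V N)} {φ : V N →ₗ[ℂ] ℂ} {v : V N} {lam : ℂ} {ξ : V N}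
  {f : ℂ → V N}

theorem IsSolutionAtZero.exists_scalar_expansion (hφv : ∀ x, Q x = φ x • v)
    (hf : IsSolutionAtZero P Q lam ξ f) :
    ∃ (a : ℕ → V N) (A : ℕ → ℂ) (u : ℂ → ℂ), a 0 = ξ ∧ HasDiscSum A u ∧
      (∀ z ∈ cutPlane, ‖z‖ < 1 → cutPow z (-lam) * ((1 - z)⁻¹ * φ (f z)) = u z) ∧
      (∀ n, A n = shiftCoeff A n + φ (a n)) ∧
      ∀ n : ℕ, (n : ℂ) • a n = P (a n) - lam • a n + shiftCoeff (fun k => A k • v) n := by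
  obtain ⟨a, g, ha0, hg, hfg⟩ := hf.exists_hasDiscSum
  have hφg := hg.map (LinearMap.toContinuousLinearMap φ)
  obtain ⟨A, hA⟩ := exists_hasDiscSum_of_differentiableOn (g := fun x => (1 - x)⁻¹ * φ (g x)) <|
    .mul (.inv (by fun_prop) fun x hx => slitPlane_ne_zero (ball_subset_unitCutPlane hx))
      hφg.differentiableOn
  refine ⟨a, A, _, ha0, hA, fun z hz hz1 => ?_, congrFun ?_, congrFun ?_⟩
  · rw [hfg z hz hz1, map_smul, smul_eq_mul, cutPow_neg]
    have := cutPow_ne_zero z lam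
    field_simp
  · refine hA.unique_of_eq_on_cutPlane (hA.smul_shift.add hφg) fun z hz _ => ?_
    have := one_sub_ne_zero_of_mem_cutPlane hz
    simp only [smul_eq_mul, LinearMap.coe_toContinuousLinearMap']
    field_simp
    ring
  · have hPg := (hg.map (LinearMap.toContinuousLinearMap P)).sub (hg.map (lam • .id ℂ (V N)))
    have hAv := (hA.map (ContinuousLinearMap.toSpanSingleton ℂ v)).smul_shift
    refine hg.smul_deriv.unique_of_eq_on_cutPlane (hPg.add hAv) fun z hz hz1 => ?_
    rw [hf.1.smul_deriv_eq hg.differentiableOn hfg hz hz1, hφv]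
    simp [mul_smul]

theorem IsSolutionAtZero.exists_scalar_recursion (hφv : ∀ x, Q x = φ x • v)
    (hf : IsSolutionAtZero P Q lam ξ f) :
    ∃ (A : ℕ → ℂ) (u : ℂ → ℂ), A 0 = φ ξ ∧ HasDiscSum A u ∧
      (∀ z ∈ cutPlane, ‖z‖ < 1 → cutPow z (-lam) * ((1 - z)⁻¹ * φ (f z)) = u z) ∧
      ∀ n : ℕ, A (n + 1) * LinearMap.det ((lam + (n + 1)) • 1 - P) =
        A n * LinearMap.det ((lam + (n + 1)) • 1 - (P - Q)) := by
  obtain ⟨a, A, u, ha0, hA, hfu, hAφ, ha⟩ := hf.exists_scalar_expansion hφv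
  refine ⟨A, u, by simpa [shiftCoeff, ha0] using hAφ 0, hA, hfu, fun n => ?_⟩
  have apply_eq : ((lam + (n + 1)) • 1 - P) (a (n + 1)) = A n • v := by
    have := ha (n + 1)
    simp only [shiftCoeff, Nat.cast_add, Nat.cast_one] at this
    simp only [LinearMap.sub_apply, LinearMap.smul_apply, Module.End.one_apply]
    rw [← sub_eq_zero] at this ⊢
    linear_combination (norm := module) this
  have hQ : Q = φ.smulRight v := LinearMap.ext hφv
  rw [sub_sub_eq_add_sub, add_sub_right_comm, hQ, mul_det_add_smulRight _ φ apply_eq,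
    hAφ (n + 1), shiftCoeff]

end RankOne

/-! ### The transport matrix -/

/-- The entry `c i j` of the transport matrix in terms of the eigenvalues `lam` of `P` and `mu` of
`P - Q`. As `Gamma` has the value `0` at its poles, so does the inverse of each factor of the
denominator. -/
noncomputable def transportCoeff {ι : Type*} [Fintype ι] [DecidableEq ι] (lam mu : ι → ℂ)
    (i j : ι) : ℂ :=
  exp (I * Real.pi * (lam i - mu j)) *
    ((∏ k ∈ Finset.univ.erase i, Gamma (lam i - lam k + 1)) *
      (∏ l ∈ Finset.univ.erase j, Gamma (mu j - mu l))) /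
    ((∏ l ∈ Finset.univ.erase j, Gamma (lam i - mu l + 1)) *
      (∏ k ∈ Finset.univ.erase i, Gamma (mu j - lam k)))

section TransportMatrix

variable {N : ℕ} {P Q : Module.End ℂ (V N)} {φ : V N →ₗ[ℂ] ℂ} {v : V N} {lam mu : Fin N → ℂ}
  {ξ ζ : Fin N → V N} {x : V N} {i j : Fin N} {f : ℂ → V N} {h : Fin N → ℂ → V N}
  {c : Fin N → ℂ}

theorem IsNonresonantEigensystem.det_smul_one_sub_sub
    (hR : IsNonresonantEigensystem φ (Q - P) (fun j => -mu j) ζ) (s : ℂ) :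
    LinearMap.det (s • 1 - (P - Q)) = ∏ j, (s - mu j) := by
  obtain ⟨b, rfl⟩ := hR.exists_basis
  refine det_smul_one_sub_eq_prod b (fun j => ?_) s
  rw [← neg_sub Q P, LinearMap.neg_apply, hR.apply_eq, neg_smul, neg_neg]

theorem cutPow_neg_mul_inv_one_sub_mul_cutPow {z : ℂ} (hz : z ∈ cutPlane) (a b : ℂ) :
    cutPow z (-a) * ((1 - z)⁻¹ * cutPow z b) =
      (-z) ^ (-(a - b + 1)) * (exp ((b - a) * (Real.pi * I)) * (1 - z⁻¹)⁻¹) := by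
  have z_ne_zero := ne_zero_of_mem_cutPlane hz
  have inv_one_sub : (1 - z)⁻¹ = (-z)⁻¹ * (1 - z⁻¹)⁻¹ := by
    rw [← mul_inv]
    congr 1
    field_simp
    ring
  have exponent : -(a - b + 1) = (b - a) - 1 := by ring
  rw [mul_left_comm, ← cutPow_add, neg_add_eq_sub, cutPow_eq_mul_cpow hz, inv_one_sub, exponent,
    cpow_sub _ 1 (neg_ne_zero.2 z_ne_zero), cpow_one]
  ring

theorem exists_expansion_at_infinity (φ : V N →ₗ[ℂ] ℂ)
    (hh : ∀ j, IsSolutionAtInfty P Q (mu j) (ζ j) (h j))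
    (hfh : ∀ z ∈ cutPlane, f z = ∑ j, c j • h j z) (a : ℂ) :
    ∃ p : Fin N → ℂ → ℂ,
      (∀ l, DifferentiableOn ℂ (p l) (Metric.ball 0 1)) ∧
      (∀ l, p l 0 = c l * exp ((mu l - a) * (Real.pi * I)) * φ (ζ l)) ∧
      ∀ z ∈ cutPlane, 1 < ‖z‖ → cutPow z (-a) * ((1 - z)⁻¹ * φ (f z)) =
        ∑ l, (-z) ^ (-(a - mu l + 1)) * p l z⁻¹ := by
  choose b r hb0 hr hhr using fun l => (hh l).exists_hasDiscSum
  refine ⟨fun l y => c l * exp ((mu l - a) * (Real.pi * I)) * ((1 - y)⁻¹ * φ (r l y)),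
    fun l => ?_, fun l => ?_, fun z hz hz1 => ?_⟩
  · have inv_differentiableOn : DifferentiableOn ℂ (fun y : ℂ => (1 - y)⁻¹) (Metric.ball 0 1) :=
      .inv (by fun_prop) fun y hy => slitPlane_ne_zero (ball_subset_unitCutPlane hy)
    exact (inv_differentiableOn.mul
      ((hr l).map (LinearMap.toContinuousLinearMap φ)).differentiableOn).const_mul _
  · dsimp only
    rw [sub_zero, inv_one, one_mul, (hr l).apply_zero, hb0]
  · rw [hfh z hz, map_sum, Finset.mul_sum, Finset.mul_sum]
    refine Finset.sum_congr rfl fun l _ => ?_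
    rw [map_smul, hhr l z hz hz1, map_smul, smul_eq_mul, smul_eq_mul]
    linear_combination c l * φ (r l z⁻¹) * cutPow_neg_mul_inv_one_sub_mul_cutPow hz a (mu l)

theorem hasCutPlaneExpansions_of_eq_sum {lam : ℂ} {A : ℕ → ℂ} {u : ℂ → ℂ}
    (hf : IsSolution P Q f) (hA : HasDiscSum A u)
    (hfu : ∀ z ∈ cutPlane, ‖z‖ < 1 → cutPow z (-lam) * ((1 - z)⁻¹ * φ (f z)) = u z)
    (hh : ∀ j, IsSolutionAtInfty P Q (mu j) (ζ j) (h j))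
    (hfh : ∀ z ∈ cutPlane, f z = ∑ j, c j • h j z) (j : Fin N) :
    HasCutPlaneExpansions (fun l => lam - mu l + 1) j
      (c j * exp ((mu j - lam) * (Real.pi * I)) * φ (ζ j)) A
      (fun z => cutPow z (-lam) * ((1 - z)⁻¹ * φ (f z))) where
  differentiableOn := fun z hz => by
    have inv_differentiableAt : DifferentiableAt ℂ (fun z : ℂ => (1 - z)⁻¹) z :=
      .inv (by fun_prop) (one_sub_ne_zero_of_mem_cutPlane hz)
    exact ((hasDerivAt_cutPow hz _).differentiableAt.mul (inv_differentiableAt.mul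
      ((LinearMap.toContinuousLinearMap φ).differentiableAt.comp z
        (hf z hz).differentiableAt))).differentiableWithinAt
  atZero := ⟨u, hA, hfu⟩
  atInfty := by
    obtain ⟨p, hp, hp0, hfp⟩ := exists_expansion_at_infinity φ hh hfh lam
    exact ⟨p, hp, hp0 j, hfp⟩

theorem coeff_eq_mul_transportCoeff (hφv : ∀ x, Q x = φ x • v)
    (hP : IsNonresonantEigensystem φ P lam ξ)
    (hR : IsNonresonantEigensystem φ (Q - P) (fun j => -mu j) ζ)
    (hf : IsSolutionAtZero P Q (lam i) x f)
    (hh : ∀ j, IsSolutionAtInfty P Q (mu j) (ζ j) (h j))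
    (hfh : ∀ z ∈ cutPlane, f z = ∑ j, c j • h j z) :
    c j = φ x * transportCoeff lam mu i j := by
  obtain ⟨A, u, hA0, hA, hfu, hrec⟩ := hf.exists_scalar_recursion hφv
  simp only [hP.det_smul_one_sub, hR.det_smul_one_sub_sub] at hrec
  have leadingCoeff_eq :=
    (hasCutPlaneExpansions_of_eq_sum hf.1 hA hfu hh hfh j).leadingCoeff_eq
      (γ := fun k => lam i - lam k + 1) (i₀ := i) (by rw [sub_self, zero_add])
      (fun k n => ?_) (fun n => ?_) fun l hl n => ?_
  · have exp_mul_exp : exp (I * Real.pi * (lam i - mu j)) * exp ((mu j - lam i) * (Real.pi * I)) =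
        1 := by
      rw [← exp_add, ← exp_zero]
      ring_nf
    have gamma_sub (k : Fin N) : lam i - lam k + 1 - (lam i - mu j + 1) = mu j - lam k := by ring
    have beta_sub (l : Fin N) : lam i - mu l + 1 - (lam i - mu j + 1) = mu j - mu l := by ring
    simp only [gamma_sub, beta_sub, hR.normalized, mul_one, hA0] at leadingCoeff_eq
    rw [transportCoeff, mul_div_assoc]
    linear_combination exp (I * Real.pi * (lam i - mu j)) * leadingCoeff_eq - c j * exp_mul_exp
  · have := hP.sub_add_natCast_ne_zero (i := i) (k := k) (.inr n.succ_ne_zero)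
    rwa [Nat.cast_succ, add_comm (n : ℂ), ← add_assoc] at this
  · convert hrec n using 4 <;> ring
  · have := hR.sub_add_natCast_ne_zero (n := n) (.inl hl)
    convert this using 2
    ring

theorem isSolutionAtZero_zero (P Q : Module.End ℂ (V N)) (lam : ℂ) :
    IsSolutionAtZero P Q lam 0 0 :=
  ⟨IsSolution.zero, 0, rfl, fun z _ _ => by simp⟩

theorem eq_zero_of_sum_smul_eq_zero (hφv : ∀ x, Q x = φ x • v)
    (hP : IsNonresonantEigensystem φ P lam ξ)
    (hR : IsNonresonantEigensystem φ (Q - P) (fun j => -mu j) ζ)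
    (hh : ∀ j, IsSolutionAtInfty P Q (mu j) (ζ j) (h j))
    (hc : ∀ z ∈ cutPlane, ∑ j, c j • h j z = 0) : c = 0 :=
  funext fun j => by
    rw [coeff_eq_mul_transportCoeff (i := j) hφv hP hR (isSolutionAtZero_zero P Q (lam j)) hh
      fun z hz => (hc z hz).symm, map_zero, zero_mul, Pi.zero_apply]

end TransportMatrix

theorem isTransportMatrix_iff {N : ℕ} {P Q : Module.End ℂ (V N)} {φ : V N →ₗ[ℂ] ℂ} {v : V N}
    {lam mu : Fin N → ℂ} {ξ ζ : Fin N → V N} (hφv : ∀ x, Q x = φ x • v)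
    (hP : IsNonresonantEigensystem φ P lam ξ)
    (hR : IsNonresonantEigensystem φ (Q - P) (fun j => -mu j) ζ) {f h : Fin N → ℂ → V N}
    (hf : ∀ i, IsSolutionAtZero P Q (lam i) (ξ i) (f i))
    (hh : ∀ j, IsSolutionAtInfty P Q (mu j) (ζ j) (h j)) {c : Fin N → Fin N → ℂ} :
    IsTransportMatrix f h c ↔ ∀ i j, c i j = transportCoeff lam mu i j := by
  have coeff_eq {i : Fin N} {b : Fin N → ℂ} (hb : ∀ z ∈ cutPlane, f i z = ∑ j, b j • h j z)
      (j : Fin N) : b j = transportCoeff lam mu i j := by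
    rw [coeff_eq_mul_transportCoeff hφv hP hR (hf i) hh hb, hP.normalized, one_mul]
  refine ⟨fun hc i => coeff_eq (hc i), fun hc i z hz => ?_⟩
  obtain ⟨b, hb⟩ := exists_eq_sum_smul (hf i).1 (fun j => (hh j).1) fun b =>
    eq_zero_of_sum_smul_eq_zero hφv hP hR hh
  simp only [hb z hz, hc, coeff_eq hb]

end BasicODE

theorem mainTheorem11_general {N : ℕ} {P Q : Module.End ℂ (BasicODE.V N)}
    {φ : BasicODE.V N →ₗ[ℂ] ℂ} {v : BasicODE.V N} (hφv : ∀ x, Q x = φ x • v)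
    {lam mu : Fin N → ℂ} {ξ ζ : Fin N → BasicODE.V N}
    (hP : BasicODE.IsNonresonantEigensystem φ P lam ξ)
    (hR : BasicODE.IsNonresonantEigensystem φ (Q - P) (fun j => -mu j) ζ) :
    (∃ f h : Fin N → ℂ → BasicODE.V N,
      (∀ i, BasicODE.IsSolutionAtZero P Q (lam i) (ξ i) (f i)) ∧
      (∀ j, BasicODE.IsSolutionAtInfty P Q (mu j) (ζ j) (h j))) ∧
    ∀ f h : Fin N → ℂ → BasicODE.V N,
      (∀ i, BasicODE.IsSolutionAtZero P Q (lam i) (ξ i) (f i)) →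
      (∀ j, BasicODE.IsSolutionAtInfty P Q (mu j) (ζ j) (h j)) →
      ∀ c : Fin N → Fin N → ℂ,
        BasicODE.IsTransportMatrix f h c ↔ ∀ i j, c i j = BasicODE.transportCoeff lam mu i j := by
  choose f hf using fun i => BasicODE.exists_isSolutionAtZero Q (hP.apply_eq i) fun _ hn =>
    hP.surjective_natCast_smul_sub i hn
  choose g hg using fun j => BasicODE.exists_isSolutionAtZero Q (hR.apply_eq j) fun _ hn =>
    hR.surjective_natCast_smul_sub j hn
  exact ⟨⟨f, _, hf, fun j => (hg j).comp_inv⟩, fun _ _ hf hh _ =>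
    BasicODE.isTransportMatrix_iff hφv hP hR hf hh⟩

theorem mainTheorem11 (N : ℕ) (P Q : Module.End ℂ (BasicODE.V N))
    (hQ : BasicODE.IsMultipleOfRankOneIdempotent Q)
    (φ : BasicODE.V N →ₗ[ℂ] ℂ) (v : BasicODE.V N) (hφv : ∀ x, Q x = φ x • v)
    (lam mu : Fin N → ℂ) (ξ ζ : Fin N → BasicODE.V N)
    (hP : BasicODE.IsNormalizedEigensystem φ v P lam ξ)
    (hR : BasicODE.IsNormalizedEigensystem φ v (Q - P) (fun j => -mu j) ζ) :
    (∃ f h : Fin N → ℂ → BasicODE.V N,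
      (∀ i, BasicODE.IsSolutionAtZero P Q (lam i) (ξ i) (f i)) ∧
      (∀ j, BasicODE.IsSolutionAtInfty P Q (mu j) (ζ j) (h j))) ∧
    ∀ f h : Fin N → ℂ → BasicODE.V N,
      (∀ i, BasicODE.IsSolutionAtZero P Q (lam i) (ξ i) (f i)) →
      (∀ j, BasicODE.IsSolutionAtInfty P Q (mu j) (ζ j) (h j)) →
      ∀ c : Fin N → Fin N → ℂ,
        BasicODE.IsTransportMatrix f h c ↔
          ∀ i j, c i j =
            Complex.exp (Complex.I * Real.pi * (lam i - mu j)) *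
              ((∏ k ∈ Finset.univ.erase i, Complex.Gamma (lam i - lam k + 1)) *
                (∏ l ∈ Finset.univ.erase j, Complex.Gamma (mu j - mu l))) /
              ((∏ l ∈ Finset.univ.erase j, Complex.Gamma (lam i - mu l + 1)) *
                (∏ k ∈ Finset.univ.erase i, Complex.Gamma (mu j - lam k))) :=
  mainTheorem11_general hφv ⟨hP.apply_eq, hP.distinct, hP.nonresonant, hP.normalized⟩
    ⟨hR.apply_eq, hR.distinct, hR.nonresonant, hR.normalized⟩
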